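/- **Setting.** Let $(\mathcal X,D)$ be a nonempty compact metric space of diameter at most $1$, and let $d\ge 0$, $\kappa>0$ be such that for every $r\in(0,1]$ the space can be covered by at most $\kappa r^{-d}$ closed balls of radius $r$ (for instance, $d$ is the covering dimension of $\mathcal X$, that is, the least such exponent, and $\kappa$ is a corresponding multiplier). Let $\mu:\mathcal X\to[0,1]$ be $1$-Lipschitz with maximizer $x_*$. In each round $t=1,\dots,T$ ($T\ge 2$) the agent pulls an arm $x_t$ and observes $y_t=\mu(x_t)+\eta_t+c_t$, where, conditionally on the past and on $x_t$, the noise $\eta_t$ is sub-Gaussian with parameter $1$ (in particular has mean zero), and where the corruption $c_t$, $|c_t|\le 1$, is chosen by a strong adversary, who may use the whole past, $x_t$ and $\eta_t$. Let $C=\sum_{t=1}^T|c_t|$ be the total corruption (unknown to the agent) and $Regret_T=T\mu(x_*)-\sum_{t=1}^T\mu(x_t)$. **Robust Zooming with level $w$ and rate $\delta'$.** Write $n(x)$ for the number of pulls of $x$, $f(x)$ for the average of the observed rewards of $x$, and $r(x)=\sqrt{(4\ln T+2\ln(2/\delta'))/n(x)}+w/n(x)$. Start with no active arms, $J=\emptyset$,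 and active space $\mathcal X_{act}=\mathcal X$. In each round: (removal) if $f(v)-f(u)\ge r(v)+2r(u)$ for some $u,v\in J$, remove one such $u$ from $J$ and the closed ball $\mathcal B(u,r(u))$ from $\mathcal X_{act}$; (activation) if $\mathcal X_{act}\not\subseteq\bigcup_{v\in J}\mathcal B(v,r(v))$, add to $J$ and pull an arbitrary uncovered arm of $\mathcal X_{act}$; (selection) otherwise pull an arm of $J$ that maximizes $f(v)+2r(v)$, ties broken arbitrarily. Then update $n$ and $f$. **BoB Robust Zooming with rate $\delta\in(0,1)$.** Let $H=\lceil T^{(d+2)/(d+4)}\rceil$, $N=\lceil\log_2T\rceil$, $M=\lceil T/H\rceil$, $\alpha=2\sqrt{\ln(3NM/\delta)}$, $\gamma=\min\{\tfrac35,\,2\sqrt{3N\ln N/(5M)}\}$, and $w_i=1$ for $i=1,\dots,N$. The rounds are split into $M$ consecutive batches of length $H$ (the last may be shorter). At the start of a batch, an index $i'$ is drawn, given the past, with probabilities $p_i=(1-\gamma)w_i/\sum_jw_j+\gamma/N$, and in this batch Robust Zooming is run afresh with level $2^{i'}$ and rate $\delta/3$. After a complete batch with observed total reward $S$, put $g=S/\bigl(2H+\sqrt{2H\ln(12T/(H\delta))}\bigr)$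 and multiply every $w_i$ by $\exp\bigl(\tfrac{\gamma}{3N}\bigl(\tfrac{g}{p_i}\mathbf 1[i=i']+\tfrac{\alpha}{p_i\sqrt{NM}}\bigr)\bigr)$ (the EXP3.P update). **Theorem.** There are constants $A$ and $p\in\mathbb N$, depending only on $d$ and $\kappa$, such that for all $T\ge2$, all $\delta\in(0,1)$ and every instance, strong adversary and run as above, with probability at least $1-\delta$, $$Regret_T\le A\,\bigl(\ln(T/\delta)\bigr)^p\Bigl(T^{\frac{d+3}{d+4}}+C^{\frac1{d+1}}\,T^{\frac{d+2}{d+3}}\Bigr).$$ -/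

import Mathlib

open MeasureTheory ProbabilityTheory
open scoped NNReal ENNReal

namespace BoB

/-! ### The metric space -/

/-- The `r`-covering number of the metric space `X` is at most `κ * r ^ (-d)` for every radius
`r ∈ (0, 1]`.  The covering dimension is the least `d ≥ 0` for which this holds for some `κ`. -/
def HasCoveringBound (X : Type*) [MetricSpace X] (d κ : ℝ) : Prop :=
  ∀ r : ℝ≥0, 0 < r → r ≤ 1 →
    ((Metric.coveringNumber r (Set.univ : Set X) : ℕ∞) : ℝ≥0∞) ≤
      ENNReal.ofReal (κ * (r : ℝ) ^ (-d))

/-! ### The base algorithm: Robust Zooming -/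

/-- The confidence radius of an arm that has been pulled `n` times, for horizon `T`, probability
rate `δ` and corruption level `C`. -/
noncomputable def radius (T : ℕ) (δ C : ℝ) (n : ℕ) : ℝ :=
  √((4 * Real.log T + 2 * Real.log (2 / δ)) / n) + C / n

/-- The memory of the Robust Zooming algorithm: active arms, active space, and for each arm its
number of pulls and its average observed reward. -/
structure ZoomState (X : Type*) where
  arms : Set X
  space : Set X
  count : X → ℕ
  mean : X → ℝ

namespace ZoomState

variable {X : Type*}

/-- The memory of a freshly started Robust Zooming algorithm. -/
def init (X : Type*) : ZoomState X where
  arms := ∅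
  space := Set.univ
  count := fun _ => 0
  mean := fun _ => 0

/-- `u` is dominated by `v`, both being active. Here `r n` is the confidence radius of an arm that
has been pulled `n` times. -/
def Dominated (r : ℕ → ℝ) (s : ZoomState X) (u v : X) : Prop :=
  u ∈ s.arms ∧ v ∈ s.arms ∧ r (s.count v) + 2 * r (s.count u) ≤ s.mean v - s.mean u

/-- The removal step: if some active arm is dominated, one such arm and its confidence ball are
removed (which one is arbitrary); otherwise nothing happens. -/
def Removal [MetricSpace X] (r : ℕ → ℝ) (s s' : ZoomState X) : Prop :=
  (∃ u v, s.Dominated r u v ∧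
    s' = { s with
      arms := s.arms \ {u}
      space := s.space \ Metric.closedBall u (r (s.count u)) }) ∨
  ((¬ ∃ u v, s.Dominated r u v) ∧ s' = s)

/-- The region covered by the confidence balls of the active arms. -/
def covered [MetricSpace X] (r : ℕ → ℝ) (s : ZoomState X) : Set X :=
  ⋃ v ∈ s.arms, Metric.closedBall v (r (s.count v))

open Classical in
/-- The memory after the arm `x` has been activated. -/
noncomputable def activate (s : ZoomState X) (x : X) : ZoomState X :=
  { s with
    arms := insert x s.arms
    count := Function.update s.count x 0
    mean := Function.update s.mean x 0 }

/-- The choice of the arm `x`: if the active space is not covered, an arbitrary uncovered arm of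
it is activated and pulled; otherwise an active arm of maximal index is pulled, ties being broken
arbitrarily. -/
def Pull [MetricSpace X] (r : ℕ → ℝ) (s : ZoomState X) (x : X) (s' : ZoomState X) : Prop :=
  (¬ s.space ⊆ s.covered r ∧ x ∈ s.space ∧ x ∉ s.covered r ∧ s' = s.activate x) ∨
  (s.space ⊆ s.covered r ∧ x ∈ s.arms ∧
    (∀ v ∈ s.arms, s.mean v + 2 * r (s.count v) ≤ s.mean x + 2 * r (s.count x)) ∧ s' = s)

open Classical in
/-- The memory after the reward `y` has been observed for the arm `x`. -/
noncomputable def observe (s : ZoomState X) (x : X) (y : ℝ) : ZoomState X :=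
  { s with
    count := Function.update s.count x (s.count x + 1)
    mean := Function.update s.mean x ((s.mean x * s.count x + y) / (s.count x + 1)) }

/-- One round of Robust Zooming, started in the memory `s`, may pull the arm `x` and, after
observing the reward `y`, end in the memory `s'`. -/
def Round [MetricSpace X] (r : ℕ → ℝ) (s : ZoomState X) (x : X) (y : ℝ) (s' : ZoomState X) :
    Prop :=
  ∃ s₁ s₂, s.Removal r s₁ ∧ s₁.Pull r x s₂ ∧ s' = s₂.observe x y

end ZoomState

/-! ### The master algorithm: EXP3.P -/

/-- The EXP3.P probability of action `j`, with exploration rate `γ` and weights `w`. -/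
noncomputable def exp3Prob {N : ℕ} (γ : ℝ) (w : Fin N → ℝ) (j : Fin N) : ℝ :=
  (1 - γ) * (w j / ∑ k, w k) + γ / N

/-- The EXP3.P weights after `b` steps, over `N` actions and with horizon `M`, if action `i b` is
played and the reward `g b` is received in step `b`. -/
noncomputable def exp3Weight {N : ℕ} (M : ℕ) (α γ : ℝ) (i : ℕ → Fin N) (g : ℕ → ℝ) :
    ℕ → Fin N → ℝ
  | 0, _ => 1
  | b + 1, j =>
      let w := exp3Weight M α γ i g b
      w j * Real.exp (γ / (3 * N) *
        ((if i b = j then g b / exp3Prob γ w j else 0) +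
          α / (exp3Prob γ w j * √((N : ℝ) * M))))

/-! ### Bandit-over-Bandit Robust Zooming -/

/-- The number `⌈log₂ T⌉` of base algorithms. -/
def numBase (T : ℕ) : ℕ := Nat.clog 2 T

/-- The corruption level `2 ^ i` of the `i`-th base algorithm, `i = 1, …, N`
(`j = i - 1` counts from zero). -/
def level {N : ℕ} (j : Fin N) : ℝ := 2 ^ ((j : ℕ) + 1)

/-- The batch length `T ^ ((d + 2) / (d + 4))`, rounded up. -/
noncomputable def batchLength (d : ℝ) (T : ℕ) : ℕ := ⌈(T : ℝ) ^ ((d + 2) / (d + 4))⌉₊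

/-- The number `⌈T / H⌉` of batches, which is the horizon of EXP3.P. -/
noncomputable def numBatch (T H : ℕ) : ℕ := ⌈(T : ℝ) / H⌉₊

/-- The EXP3.P parameter `α` for `N` actions, `M` steps and probability rate `δ / 3`. -/
noncomputable def alpha (N M : ℕ) (δ : ℝ) : ℝ := 2 * √(Real.log (3 * N * M / δ))

/-- The EXP3.P exploration rate `γ` for `N` actions and `M` steps. -/
noncomputable def gamma (N M : ℕ) : ℝ := min (3 / 5) (2 * √(3 * N * Real.log N / (5 * M)))

/-- The sum of the observed rewards `y` over the `b`-th batch of length `H`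
(rounds and batches count from zero), divided by its high-probability bound. -/
noncomputable def batchReward (T H : ℕ) (δ : ℝ) (y : ℕ → ℝ) (b : ℕ) : ℝ :=
  (∑ t ∈ Finset.Ico (b * H) ((b + 1) * H), y t) /
    (2 * H + √(2 * H * Real.log (12 * T / (H * δ))))

/-- The probability with which the base algorithm `j` is chosen for the `b`-th batch, given the
base algorithms `i` chosen and the rewards `y` observed in the earlier batches. -/
noncomputable def masterProb (T H : ℕ) (δ : ℝ) (i : ℕ → Fin (numBase T)) (y : ℕ → ℝ) (b : ℕ)
    (j : Fin (numBase T)) : ℝ :=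
  let γ := gamma (numBase T) (numBatch T H)
  exp3Prob γ
    (exp3Weight (numBatch T H) (alpha (numBase T) (numBatch T H) δ) γ i (batchReward T H δ y) b) j

/-! ### The interaction

Rounds are numbered `0, …, T - 1`. In the filtration `ℱ`, the σ-algebra `ℱ (2 * t)` describes what
has happened before round `t`, and `ℱ (2 * t + 1)` describes this together with the choice of the
arm of round `t` (and of the base algorithm, if a batch starts in round `t`). The noise and the
corruption of round `t` are known at `2 * t + 2`. -/

section Interaction

variable {X Ω : Type*} [mΩ : MeasurableSpace Ω]

/-- The corrupted reward `μ (x t) + η t + c t` of round `t`. -/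
def reward (μ : X → ℝ) (x : ℕ → Ω → X) (η c : ℕ → Ω → ℝ) (t : ℕ) (ω : Ω) : ℝ :=
  μ (x t ω) + η t ω + c t ω

/-- The noise `η` and the corruption `c` come from a stochastic environment and a strong adversary:
given the past and the current arm, the noise is sub-Gaussian with parameter `1`
(so that it has mean zero), and the corruption of a round, which is at most `1`, may depend on
the whole past and on the arm and the noise of that round. -/
structure IsEnvironment (P : Measure Ω) (ℱ : Filtration ℕ mΩ) (T : ℕ) (η c : ℕ → Ω → ℝ) :
    Prop where
  measurable_noise : ∀ t < T, Measurable[ℱ (2 * t + 2)] (η t)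
  integrable_exp_noise : ∀ t < T, ∀ l : ℝ, Integrable (fun ω => Real.exp (l * η t ω)) P
  subgaussian_noise : ∀ t < T, ∀ l : ℝ,
    P[fun ω => Real.exp (l * η t ω) | ℱ (2 * t + 1)] ≤ᵐ[P] fun _ => Real.exp (l ^ 2 / 2)
  measurable_corruption : ∀ t < T, Measurable[ℱ (2 * t + 2)] (c t)
  corruption_le_one : ∀ t < T, ∀ ω, |c t ω| ≤ 1

/-- The chosen base algorithms `i` (one for each batch) and the pulled arms `x` are those of
Bandit-over-Bandit Robust Zooming with horizon `T`, batch length `H` and probability rate `δ`,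
when the observed rewards are `y`. -/
structure IsRun [MetricSpace X] [MeasurableSpace X] (P : Measure Ω) (ℱ : Filtration ℕ mΩ)
    (T H : ℕ) (δ : ℝ) (i : ℕ → Ω → Fin (numBase T)) (x : ℕ → Ω → X) (y : ℕ → Ω → ℝ) :
    Prop where
  measurable_base : ∀ b, b * H < T → Measurable[ℱ (2 * (b * H) + 1)] (i b)
  measurable_arm : ∀ t < T, Measurable[ℱ (2 * t + 1)] (x t)
  /-- At the start of a batch the base algorithm is drawn by EXP3.P. -/
  law_base : ∀ b, b * H < T → ∀ j,
    P[(i b ⁻¹' {j}).indicator (fun _ => (1 : ℝ)) | ℱ (2 * (b * H))] =ᵐ[P]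
      fun ω => masterProb T H δ (fun k => i k ω) (fun t => y t ω) b j
  /-- In each batch the chosen base algorithm is run afresh, with probability rate `δ / 3`;
  `s t` is its memory at the start of round `t`, before a possible restart. -/
  zooming : ∀ ω, ∃ s : ℕ → ZoomState X, ∀ t < T,
    ZoomState.Round (radius T (δ / 3) (level (i (t / H) ω)))
      (if H ∣ t then ZoomState.init X else s t) (x t ω) (y t ω) (s (t + 1))

/-- The regret over `T` rounds, `xopt` being an optimal arm. -/
def regret (μ : X → ℝ) (xopt : X) (T : ℕ) (x : ℕ → Ω → X) (ω : Ω) : ℝ :=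
  T * μ xopt - ∑ t ∈ Finset.range T, μ (x t ω)

/-- The total corruption spent by the adversary on the pulled arms. -/
def totalCorruption (T : ℕ) (c : ℕ → Ω → ℝ) (ω : Ω) : ℝ :=
  ∑ t ∈ Finset.range T, |c t ω|

end Interaction

end BoB

namespace BoB

/-! ### Concentration -/

section Concentration

variable {Ω : Type*} {m mΩ : MeasurableSpace Ω}

/-! Consider first a batch run with a level `w` that is at least the total corruption. With high
probability the average reward of an arm pulled `n` times is within its confidence radius of its
mean: the root term absorbs the noise, `w / n` the corruption. Three facts follow. Removal cannot
lose the optimum unless an equally good arm stays active. By optimism, the gap of every pulled arm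
is at most six times its radius. And two pulled arms are further apart than the smaller of their
radii, so the covering bound limits how many arms have radius at least `ρ`. Summing gaps over arms
gives, up to logarithms, batch regret `ρ H + √(ρ^(-d) H) + ρ^(-d) w`, of order `ρ H` for `ρ = max
(H^(-1/(d+2))) ((w/H)^(1/(d+1)))` (`ZoomInvariant.pull_observe`, `sum_gap_le`, `sum_gap_le_max`).

The corruption is unknown, so EXP3.P must find a good level. Against an adaptive adversary the
rewards that level `j` would have earned in other batches are not a usable benchmark. The argument
avoids them: in each batch where `j` is really drawn, the normalised reward is at least a constant
`v`, the optimal batch reward minus regret, noise and corruption. Hence the importance weighted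
reward of `j`, with the bonus of EXP3.P, is at least `v` times the importance weighted number of
draws of `j` with its bonus, and the latter is nearly the number of batches. The potential argument
of EXP3.P then shows that the total reward is at least `v` per batch up to order `√M`
(`exp3_sum_le`, `path_regret_le`).

All probability enters through one Chernoff bound for exponential supermartingales
(`measure_le_sum_le_exp_neg`). The arms are random and form a possibly uncountable space, so the
noise is controlled for every pair `(s, n)`: the first `n` pulls, from round `s` on, of the arm
pulled in round `s`. The right `j` depends on the random corruption, so the master is controlled for
all `j` at once.

The batch length makes the base regret `T H^(-1/(d+2))` and the master regret `H √M` both of order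
`T^((d+3)/(d+4))`. A level between `C` and `2 + 2C` yields the corruption term (`exists_level`,
`total_le`). -/

theorem lintegral_mul_le_of_setLIntegral_le (hm : m ≤ mΩ) (P : Measure Ω)
    {g : Ω → ℝ≥0∞} (hg : Measurable g)
    (h : ∀ A, MeasurableSet[m] A → ∫⁻ ω in A, g ω ∂P ≤ P A)
    {f : Ω → ℝ≥0∞} (hf : Measurable[m] f) : ∫⁻ ω, g ω * f ω ∂P ≤ ∫⁻ ω, f ω ∂P := by
  have h1 : ∫⁻ ω, g ω * f ω ∂P = ∫⁻ ω, f ω ∂(P.withDensity g) :=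
    (lintegral_withDensity_eq_lintegral_mul P hg (hf.mono hm le_rfl)).symm
  -- The hypothesis says that on `m` the measure with density `g` is at most `P`, and `f` sees only
  -- this restriction. It expresses that the conditional mean of `g` is at most 1, without any
  -- integrability.
  rw [h1, ← lintegral_trim hm hf, ← lintegral_trim hm hf]
  refine lintegral_mono' (Measure.le_iff.2 fun A hA => ?_) le_rfl
  rw [trim_measurableSet_eq hm hA, trim_measurableSet_eq hm hA, withDensity_apply _ (hm A hA)]
  exact h A hA

/-- A Chernoff bound for sums whose exponentials form a supermartingale. -/
theorem measure_le_sum_le_exp_neg (P : Measure Ω) [IsProbabilityMeasure P]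
    (𝒢 : ℕ → MeasurableSpace Ω) (hmono : Monotone 𝒢) (hle : ∀ b, 𝒢 b ≤ mΩ)
    (D : ℕ → Ω → ℝ) (n : ℕ) (hD : ∀ b < n, Measurable[𝒢 (b + 1)] (D b))
    (hstep : ∀ b < n, ∀ A, MeasurableSet[𝒢 b] A →
      ∫⁻ ω in A, ENNReal.ofReal (Real.exp (D b ω)) ∂P ≤ P A) (a : ℝ) :
    P {ω | a ≤ ∑ b ∈ Finset.range n, D b ω} ≤ ENNReal.ofReal (Real.exp (-a)) := by
  have key : ∀ k ≤ n, Measurable[𝒢 k]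
        (fun ω => ENNReal.ofReal (Real.exp (∑ b ∈ Finset.range k, D b ω))) ∧
      ∫⁻ ω, ENNReal.ofReal (Real.exp (∑ b ∈ Finset.range k, D b ω)) ∂P ≤ 1 := by
    intro k hk
    induction k with
    | zero => simp
    | succ k ih =>
      obtain ⟨ih1, ih2⟩ := ih (by omega)
      have hDk := hD k (by omega)
      have hmeasD : Measurable[𝒢 (k + 1)] (fun ω => ENNReal.ofReal (Real.exp (D k ω))) :=
        ENNReal.measurable_ofReal.comp (Real.measurable_exp.comp hDk)
      have heq : (fun ω => ENNReal.ofReal (Real.exp (∑ b ∈ Finset.range (k + 1), D b ω))) =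
          fun ω => ENNReal.ofReal (Real.exp (D k ω)) *
            ENNReal.ofReal (Real.exp (∑ b ∈ Finset.range k, D b ω)) := by
        funext ω
        rw [Finset.sum_range_succ, add_comm, Real.exp_add, ENNReal.ofReal_mul (Real.exp_pos _).le]
      rw [heq]
      refine ⟨hmeasD.mul (ih1.mono (hmono (Nat.le_succ k)) le_rfl), ?_⟩
      refine (lintegral_mul_le_of_setLIntegral_le (hle k) P (hmeasD.mono (hle _) le_rfl)
        (hstep k (by omega)) ih1).trans ih2
  obtain ⟨hmeas, hint⟩ := key n le_rfl
  have hmk := meas_ge_le_lintegral_div (μ := P) (hmeas.mono (hle n) le_rfl).aemeasurable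
    (ε := ENNReal.ofReal (Real.exp a)) (by simp [Real.exp_pos]) ENNReal.ofReal_ne_top
  calc P {ω | a ≤ ∑ b ∈ Finset.range n, D b ω}
      ≤ P {ω | ENNReal.ofReal (Real.exp a) ≤
          ENNReal.ofReal (Real.exp (∑ b ∈ Finset.range n, D b ω))} :=
        measure_mono fun ω hω => ENNReal.ofReal_le_ofReal (Real.exp_le_exp.2 hω)
    _ ≤ 1 / ENNReal.ofReal (Real.exp a) := hmk.trans (ENNReal.div_le_div_right hint _)
    _ = ENNReal.ofReal (Real.exp (-a)) := by
        rw [Real.exp_neg, ENNReal.ofReal_inv_of_pos (Real.exp_pos a), one_div]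

/-- The supermartingale step for an event of conditional probability `p`. -/
theorem setLIntegral_exp_ite_le (hm : m ≤ mΩ) (P : Measure Ω)
    [IsProbabilityMeasure P] {B : Set Ω} (hB : MeasurableSet B) {p D₁ D₀ : Ω → ℝ}
    (hp : P[B.indicator (fun _ => (1 : ℝ)) | m] =ᵐ[P] p) (hpm : Measurable[m] p)
    (hp0 : ∀ ω, 0 ≤ p ω) (hp1 : ∀ ω, p ω ≤ 1)
    (h₁ : Measurable[m] D₁) (h₀ : Measurable[m] D₀)
    (hle : ∀ ω, p ω * Real.exp (D₁ ω) + (1 - p ω) * Real.exp (D₀ ω) ≤ 1)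
    {A : Set Ω} (hA : MeasurableSet[m] A) :
    ∫⁻ ω in A, ENNReal.ofReal (Real.exp (B.indicator D₁ ω + Bᶜ.indicator D₀ ω)) ∂P ≤ P A := by
  have hpint : Integrable p P := integrable_condExp.congr hp
  have set_eq : ∀ S, MeasurableSet[m] S → ∫ ω in S, p ω ∂P = P.real (S ∩ B) := by
    intro S hS
    rw [← setIntegral_congr_ae (g := p) (hm S hS) (hp.mono fun ω h _ => h),
      setIntegral_condExp hm ((integrable_const (1 : ℝ)).indicator hB) hS,
      setIntegral_indicator hB]
    simp
  -- On `m`, restricting `P` to `B` amounts to giving it the density `p`, and similarly for the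
  -- complement and `1 - p`. Integrals of `m`-measurable functions over the two pieces can then be
  -- joined under one integral, where `hle` applies pointwise.
  have hB1 : (P.restrict B).trim hm = (P.withDensity fun ω => ENNReal.ofReal (p ω)).trim hm := by
    refine @Measure.ext Ω m _ _ fun S hS => ?_
    rw [trim_measurableSet_eq hm hS, trim_measurableSet_eq hm hS, withDensity_apply _ (hm S hS),
      Measure.restrict_apply (hm S hS),
      ← ofReal_integral_eq_lintegral_ofReal hpint.integrableOn (ae_of_all _ hp0), set_eq S hS]
    simp
  have hB0 : (P.restrict Bᶜ).trim hm =
      (P.withDensity fun ω => ENNReal.ofReal (1 - p ω)).trim hm := by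
    refine @Measure.ext Ω m _ _ fun S hS => ?_
    rw [trim_measurableSet_eq hm hS, trim_measurableSet_eq hm hS, withDensity_apply _ (hm S hS),
      Measure.restrict_apply (hm S hS),
      ← ofReal_integral_eq_lintegral_ofReal (f := fun ω => 1 - p ω)
        ((integrable_const 1).sub hpint).integrableOn (ae_of_all _ fun ω => sub_nonneg.2 (hp1 ω)),
      integral_sub (integrable_const 1).integrableOn hpint.integrableOn, set_eq S hS]
    have h2 : P.real S = P.real (S ∩ B) + P.real (S ∩ Bᶜ) := by
      rw [← Set.sdiff_eq, measureReal_inter_add_sdiff hB]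
    have h3 : (∫ _ in S, (1 : ℝ) ∂P) - P.real (S ∩ B) = P.real (S ∩ Bᶜ) := by
      simp [h2]
    rw [h3]; simp
  have conv : ∀ {C : Set Ω} {q : Ω → ℝ} {F : Ω → ℝ≥0∞}, Measurable[m] q →
      (P.restrict C).trim hm = (P.withDensity fun ω => ENNReal.ofReal (q ω)).trim hm →
      Measurable[m] F → ∫⁻ ω in C, F ω ∂P = ∫⁻ ω, ENNReal.ofReal (q ω) * F ω ∂P := by
    intro C q F hq hC hF
    rw [← lintegral_trim hm hF, hC, lintegral_trim hm hF]
    exact lintegral_withDensity_eq_lintegral_mul P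
      (ENNReal.measurable_ofReal.comp (hq.mono hm le_rfl)) (hF.mono hm le_rfl)
  have hF : ∀ {D : Ω → ℝ}, Measurable[m] D →
      Measurable[m] (A.indicator fun ω => ENNReal.ofReal (Real.exp (D ω))) := fun hD =>
    (ENNReal.measurable_ofReal.comp (Real.measurable_exp.comp hD)).indicator hA
  rw [← lintegral_indicator (hm A hA), ← lintegral_add_compl _ hB]
  have e1 : ∫⁻ ω in B, A.indicator
      (fun ω => ENNReal.ofReal (Real.exp (B.indicator D₁ ω + Bᶜ.indicator D₀ ω))) ω ∂P =
      ∫⁻ ω in B, A.indicator (fun ω => ENNReal.ofReal (Real.exp (D₁ ω))) ω ∂P := by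
    refine setLIntegral_congr_fun hB fun ω hω => ?_
    by_cases hωA : ω ∈ A <;> simp [hωA, hω]
  have e0 : ∫⁻ ω in Bᶜ, A.indicator
      (fun ω => ENNReal.ofReal (Real.exp (B.indicator D₁ ω + Bᶜ.indicator D₀ ω))) ω ∂P =
      ∫⁻ ω in Bᶜ, A.indicator (fun ω => ENNReal.ofReal (Real.exp (D₀ ω))) ω ∂P := by
    refine setLIntegral_congr_fun hB.compl fun ω hω => ?_
    have hω' : ω ∉ B := hω
    by_cases hωA : ω ∈ A <;> simp [hωA, hω']
  rw [e1, e0, conv hpm hB1 (hF h₁), conv (hpm.const_sub 1) hB0 (hF h₀),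
    ← lintegral_add_left]
  · calc _ ≤ ∫⁻ ω, A.indicator 1 ω ∂P := by
          refine lintegral_mono fun ω => ?_
          by_cases hωA : ω ∈ A
          · simp only [hωA, Set.indicator_of_mem, Pi.one_apply]
            rw [← ENNReal.ofReal_mul (hp0 ω), ← ENNReal.ofReal_mul (sub_nonneg.2 (hp1 ω)),
              ← ENNReal.ofReal_add (mul_nonneg (hp0 ω) (Real.exp_pos _).le)
                (mul_nonneg (sub_nonneg.2 (hp1 ω)) (Real.exp_pos _).le)]
            exact ENNReal.ofReal_le_one.2 (hle ω)
          · simp [hωA]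
      _ = P A := lintegral_indicator_one (hm A hA)
  · exact (ENNReal.measurable_ofReal.comp (hpm.mono hm le_rfl)).mul ((hF h₁).mono hm le_rfl)

/-- The supermartingale step for conditionally sub-Gaussian noise, restricted to a predictable
event. -/
theorem setLIntegral_exp_indicator_le (hm : m ≤ mΩ) (P : Measure Ω)
    [IsProbabilityMeasure P] {η : Ω → ℝ} {l : ℝ}
    (hint : Integrable (fun ω => Real.exp (l * η ω)) P)
    (hsub : P[fun ω => Real.exp (l * η ω) | m] ≤ᵐ[P] fun _ => Real.exp (l ^ 2 / 2))
    {B : Set Ω} (hB : MeasurableSet[m] B) {A : Set Ω} (hA : MeasurableSet[m] A) :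
    ∫⁻ ω in A, ENNReal.ofReal (Real.exp (B.indicator (fun ω => l * η ω - l ^ 2 / 2) ω)) ∂P ≤
      P A := by
  rw [← lintegral_inter_add_sdiff _ A (hm B hB), ← measure_inter_add_sdiff A (hm B hB)]
  have hAB : MeasurableSet[m] (A ∩ B) := hA.inter hB
  refine add_le_add ?_ (le_of_eq ?_)
  · calc _ = ∫⁻ ω in A ∩ B, ENNReal.ofReal (Real.exp (-(l ^ 2 / 2)) * Real.exp (l * η ω)) ∂P := by
          refine setLIntegral_congr_fun (hm _ hAB) fun ω hω => ?_
          simp only [hω.2, Set.indicator_of_mem]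
          rw [← Real.exp_add]; ring_nf
      _ = ENNReal.ofReal (∫ ω in A ∩ B, Real.exp (-(l ^ 2 / 2)) * Real.exp (l * η ω) ∂P) := by
          rw [ofReal_integral_eq_lintegral_ofReal (hint.const_mul _).integrableOn
            (ae_of_all _ fun ω => by positivity)]
      _ ≤ ENNReal.ofReal (P.real (A ∩ B)) := by
          refine ENNReal.ofReal_le_ofReal ?_
          rw [integral_const_mul, ← setIntegral_condExp hm hint hAB]
          calc _ ≤ Real.exp (-(l ^ 2 / 2)) * ∫ ω in A ∩ B, Real.exp (l ^ 2 / 2) ∂P := by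
                refine mul_le_mul_of_nonneg_left ?_ (Real.exp_pos _).le
                exact setIntegral_mono_ae integrable_condExp.integrableOn
                  (integrable_const _).integrableOn hsub
            _ = P.real (A ∩ B) := by
                simp only [integral_const, smul_eq_mul, measureReal_restrict_apply_univ]
                rw [mul_left_comm, ← Real.exp_add]; simp
      _ = P (A ∩ B) := by simp
  · calc _ = ∫⁻ ω in A \ B, 1 ∂P := by
          refine setLIntegral_congr_fun ((hm _ hA).diff (hm _ hB)) fun ω hω => ?_
          simp [hω.2]
      _ = _ := by simp

variable {P : Measure Ω} [IsProbabilityMeasure P] {ℱ : Filtration ℕ mΩ} {T : ℕ} {η c : ℕ → Ω → ℝ}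

theorem IsEnvironment.measure_le_sum_indicator_le (hE : IsEnvironment P ℱ T η c)
    {B : ℕ → Set Ω} (hB : ∀ t < T, MeasurableSet[ℱ (2 * t + 1)] (B t)) (l a : ℝ) :
    P {ω | a ≤ ∑ t ∈ Finset.range T, (B t).indicator (fun ω => l * η t ω - l ^ 2 / 2) ω} ≤
      ENNReal.ofReal (Real.exp (-a)) := by
  refine measure_le_sum_le_exp_neg P (fun t => ℱ (2 * t + 1))
    (fun s t h => ℱ.mono (by omega)) (fun t => ℱ.le _) _ T (fun t ht => ?_)
    (fun t ht A hA => ?_) a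
  · have h1 : Measurable[ℱ (2 * (t + 1) + 1)] (η t) :=
      (hE.measurable_noise t ht).mono (ℱ.mono (by omega)) le_rfl
    exact ((h1.const_mul l).sub_const _).indicator (ℱ.mono (by omega) _ (hB t ht))
  · exact setLIntegral_exp_indicator_le (ℱ.le _) P (hE.integrable_exp_noise t ht l)
      (hE.subgaussian_noise t ht l) (hB t ht) hA

open Classical in
/-- The noise of `n` predictably chosen rounds. -/
theorem IsEnvironment.measure_sqrt_lt_abs_sum_le (hE : IsEnvironment P ℱ T η c)
    {B : ℕ → Set Ω} (hB : ∀ t < T, MeasurableSet[ℱ (2 * t + 1)] (B t)) {n : ℕ} (hn : 0 < n)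
    {a : ℝ} (ha : 0 ≤ a) :
    P {ω | ((Finset.range T).filter fun t => ω ∈ B t).card = n ∧
        √(2 * a * n) < |∑ t ∈ (Finset.range T).filter fun t => ω ∈ B t, η t ω|} ≤
      ENNReal.ofReal (2 * Real.exp (-a)) := by
  have hn' : (0 : ℝ) < n := by exact_mod_cast hn
  -- This `l` maximises `l * s - n * l ^ 2 / 2` at `s = √(2 * a * n)`, where the value is `a`. It is
  -- deterministic because `n` is fixed; the lower tail uses `-l`.
  set l := √(2 * a / n) with hl
  have hl0 : 0 ≤ l := Real.sqrt_nonneg _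
  have hl2 : l ^ 2 = 2 * a / n := Real.sq_sqrt (by positivity)
  have hln : l * √(2 * a * n) = 2 * a := by
    rw [hl, ← Real.sqrt_mul (by positivity)]
    rw [show 2 * a / n * (2 * a * n) = (2 * a) ^ 2 by field_simp]
    exact Real.sqrt_sq (by positivity)
  have hsum : ∀ (k : ℝ) ω, ((Finset.range T).filter fun t => ω ∈ B t).card = n →
      ∑ t ∈ Finset.range T, (B t).indicator (fun ω => k * η t ω - k ^ 2 / 2) ω =
        k * (∑ t ∈ (Finset.range T).filter fun t => ω ∈ B t, η t ω) - n * (k ^ 2 / 2) := by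
    intro k ω hω
    simp only [Set.indicator_apply]
    rw [← Finset.sum_filter, Finset.sum_sub_distrib, ← Finset.mul_sum, Finset.sum_const, hω,
      nsmul_eq_mul]
  have hna : (n : ℝ) * (l ^ 2 / 2) = a := by rw [hl2]; field_simp
  calc _ ≤ P ({ω | a ≤ ∑ t ∈ Finset.range T,
            (B t).indicator (fun ω => l * η t ω - l ^ 2 / 2) ω} ∪
          {ω | a ≤ ∑ t ∈ Finset.range T,
            (B t).indicator (fun ω => -l * η t ω - (-l) ^ 2 / 2) ω}) := by
        refine measure_mono fun ω hω => ?_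
        obtain ⟨h1, h2⟩ := hω
        rcases lt_abs.1 h2 with h | h
        · left
          have := mul_le_mul_of_nonneg_left h.le hl0
          simp only [Set.mem_ofPred_eq]
          rw [hsum l ω h1]
          linarith
        · right
          have := mul_le_mul_of_nonneg_left h.le hl0
          simp only [Set.mem_ofPred_eq]
          rw [hsum (-l) ω h1, neg_sq]
          linarith
    _ ≤ ENNReal.ofReal (Real.exp (-a)) + ENNReal.ofReal (Real.exp (-a)) :=
        (measure_union_le _ _).trans (add_le_add (hE.measure_le_sum_indicator_le hB l a)
          (hE.measure_le_sum_indicator_le hB (-l) a))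
    _ = _ := by
        rw [← ENNReal.ofReal_add (Real.exp_pos _).le (Real.exp_pos _).le, two_mul]

end Concentration

/-! ### Regret of Robust Zooming on a fixed sequence of rewards -/

section Zooming

variable {X : Type*}

open Classical in
/-- The number of pulls of `v` in the first `k` rounds. -/
noncomputable def pulls (x : ℕ → X) (k : ℕ) (v : X) : ℕ :=
  ((Finset.range k).filter fun t => x t = v).card

open Classical in
/-- The sum of `y` over the pulls of `v` in the first `k` rounds. -/
noncomputable def pullSum (x : ℕ → X) (y : ℕ → ℝ) (k : ℕ) (v : X) : ℝ :=
  ∑ t ∈ (Finset.range k).filter fun t => x t = v, y t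

theorem pulls_zero (x : ℕ → X) (v : X) : pulls x 0 v = 0 := by simp [pulls]

theorem pulls_succ_self (x : ℕ → X) (k : ℕ) : pulls x (k + 1) (x k) = pulls x k (x k) + 1 := by
  simp [pulls, Finset.range_add_one, Finset.filter_insert]

theorem pulls_succ_of_ne (x : ℕ → X) (k : ℕ) {v : X} (h : v ≠ x k) :
    pulls x (k + 1) v = pulls x k v := by
  simp [pulls, Finset.range_add_one, Finset.filter_insert, h.symm]

theorem pullSum_zero (x : ℕ → X) (y : ℕ → ℝ) (v : X) : pullSum x y 0 v = 0 := by simp [pullSum]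

theorem pullSum_succ_self (x : ℕ → X) (y : ℕ → ℝ) (k : ℕ) :
    pullSum x y (k + 1) (x k) = pullSum x y k (x k) + y k := by
  simp [pullSum, Finset.range_add_one, Finset.filter_insert, add_comm]

theorem pullSum_succ_of_ne (x : ℕ → X) (y : ℕ → ℝ) (k : ℕ) {v : X} (h : v ≠ x k) :
    pullSum x y (k + 1) v = pullSum x y k v := by
  simp [pullSum, Finset.range_add_one, Finset.filter_insert, h.symm]

variable [MetricSpace X]

/-- The invariants of Robust Zooming after `k` rounds. -/
structure ZoomInvariant (r : ℕ → ℝ) (μ : X → ℝ) (xopt : X) (x : ℕ → X) (y : ℕ → ℝ) (k : ℕ)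
    (s : ZoomState X) : Prop where
  count_eq : ∀ v, s.count v = pulls x k v
  mean_mul : ∀ v, s.mean v * pulls x k v = pullSum x y k v
  pulls_pos : ∀ v ∈ s.arms, 0 < pulls x k v
  removed : ∀ u, 0 < pulls x k u →
    u ∈ s.arms ∨ Disjoint (Metric.closedBall u (r (pulls x k u))) s.space
  separated : ∀ u v, 0 < pulls x k u → 0 < pulls x k v → u ≠ v →
    min (r (pulls x k u)) (r (pulls x k v)) < dist u v
  optimal : xopt ∈ s.space ∨ ∃ v ∈ s.arms, μ v = μ xopt
  gap_le : ∀ v, 0 < pulls x k v → μ xopt - μ v ≤ 6 * r (pulls x k v)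

variable {r : ℕ → ℝ} {μ : X → ℝ} {xopt : X} {x : ℕ → X} {y : ℕ → ℝ} {k : ℕ}
  {s s' : ZoomState X}

theorem ZoomInvariant.init : ZoomInvariant r μ xopt x y 0 (ZoomState.init X) where
  count_eq v := by simp [ZoomState.init, pulls_zero]
  mean_mul v := by simp [pulls_zero, pullSum_zero]
  pulls_pos v hv := by simp [ZoomState.init] at hv
  removed u hu := by simp [pulls_zero] at hu
  separated u v hu := by simp [pulls_zero] at hu
  optimal := by simp [ZoomState.init]
  gap_le v hv := by simp [pulls_zero] at hv

theorem ZoomInvariant.abs_mean_sub_le (h : ZoomInvariant r μ xopt x y k s)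
    (hconf : ∀ v, 0 < pulls x k v → |pullSum x y k v / pulls x k v - μ v| ≤ r (pulls x k v))
    {v : X} (hv : v ∈ s.arms) : |s.mean v - μ v| ≤ r (s.count v) := by
  have hpos := h.pulls_pos v hv
  have h1 : s.mean v = pullSum x y k v / pulls x k v :=
    eq_div_of_mul_eq (by exact_mod_cast hpos.ne') (h.mean_mul v)
  rw [h1, h.count_eq]
  exact hconf v hpos

/-- With valid confidence bounds, `v` dominating `u` forces `μ u + r u ≤ μ v`. By the Lipschitz
property `μ v` is then at least every value of `μ` on the removed ball. So if that ball contains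
`xopt`, the arm `v` is itself optimal; and an active optimal arm is never removed. -/
theorem ZoomInvariant.removal (h : ZoomInvariant r μ xopt x y k s)
    (hr : ∀ n, 0 < n → 0 < r n) (hμ : LipschitzWith 1 μ) (hopt : ∀ x, μ x ≤ μ xopt)
    (hconf : ∀ v, 0 < pulls x k v → |pullSum x y k v / pulls x k v - μ v| ≤ r (pulls x k v))
    (hs : s.Removal r s') : ZoomInvariant r μ xopt x y k s' := by
  rcases hs with ⟨u, v, ⟨hu, hv, huv⟩, rfl⟩ | ⟨-, rfl⟩
  swap; · exact h
  have hcu := abs_le.1 (h.abs_mean_sub_le hconf hu)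
  have hcv := abs_le.1 (h.abs_mean_sub_le hconf hv)
  have hru : 0 < r (s.count u) := hr _ (by rw [h.count_eq]; exact h.pulls_pos u hu)
  have hbetter : μ u + r (s.count u) ≤ μ v := by linarith
  have hvne : v ≠ u := by rintro rfl; linarith
  refine ⟨h.count_eq, h.mean_mul, fun w hw => h.pulls_pos w hw.1, fun w hw => ?_, h.separated, ?_,
    h.gap_le⟩
  · by_cases hwu : w = u
    · right
      subst hwu
      rw [← h.count_eq]
      exact Set.disjoint_sdiff_right
    · rcases h.removed w hw with h1 | h1
      · exact Or.inl ⟨h1, hwu⟩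
      · exact Or.inr (h1.mono_right Set.sdiff_subset)
  · rcases h.optimal with h1 | ⟨w, hw, hwopt⟩
    · by_cases hx : xopt ∈ Metric.closedBall u (r (s.count u))
      · right
        have hd := (hμ.dist_le_mul xopt u).trans
          (by simpa using Metric.mem_closedBall.1 hx : _ ≤ r (s.count u))
        rw [Real.dist_eq] at hd
        have := (abs_le.1 hd).2
        exact ⟨v, ⟨hv, hvne⟩, le_antisymm (hopt v) (by linarith)⟩
      · exact Or.inl ⟨h1, hx⟩
    · refine Or.inr ⟨w, ⟨hw, ?_⟩, hwopt⟩
      rintro rfl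
      linarith [hopt v]

/-- The gap bound comes from optimism when an active arm is selected, and from `1 ≤ r 1` when a new
arm is activated. Separation comes from the activation rule, because `removed` keeps new arms away
from the balls of the discarded arms too. -/
theorem ZoomInvariant.pull_observe (h : ZoomInvariant r μ xopt x y k s)
    (hr0 : ∀ n, 0 ≤ r n) (hr1 : 1 ≤ r 1)
    (hanti : ∀ n, 0 < n → r (n + 1) ≤ r n) (hdbl : ∀ n, 0 < n → r n ≤ 2 * r (n + 1))
    (hμ : LipschitzWith 1 μ) (hμ01 : ∀ x, μ x ∈ Set.Icc (0 : ℝ) 1)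
    (hconf : ∀ v, 0 < pulls x k v → |pullSum x y k v / pulls x k v - μ v| ≤ r (pulls x k v))
    (hs : s.Pull r (x k) s') : ZoomInvariant r μ xopt x y (k + 1) (s'.observe (x k) (y k)) := by
  -- what the two kinds of pull have in common
  have common : s'.arms = insert (x k) s.arms ∧ s'.space = s.space ∧
      (∀ v, s'.count v = pulls x k v) ∧ (∀ v, s'.mean v * pulls x k v = pullSum x y k v) ∧
      μ xopt - μ (x k) ≤ 6 * r (pulls x k (x k) + 1) ∧
      (pulls x k (x k) = 0 → ∀ u, 0 < pulls x k u → r (pulls x k u) < dist (x k) u) := by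
    rcases hs with ⟨-, hsp, hcov, rfl⟩ | ⟨hcov, harm, hmax, rfl⟩
    -- The activated point is outside the balls of the active arms, being uncovered, and outside
    -- those of the removed arms, being in the active space. In particular it was never pulled, so
    -- resetting its statistics loses nothing.
    · have hfar : ∀ u, 0 < pulls x k u → r (pulls x k u) < dist (x k) u := by
        intro u hu
        rw [← not_le, ← Metric.mem_closedBall]
        intro hmem
        rcases h.removed u hu with h1 | h1
        · exact hcov (Set.mem_biUnion h1 (by rwa [h.count_eq]))
        · exact Set.disjoint_left.1 h1 hmem hsp
      have h0 : pulls x k (x k) = 0 := by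
        by_contra hne
        have := hfar (x k) (Nat.pos_of_ne_zero hne)
        rw [dist_self] at this
        exact absurd (hr0 _) (not_le.2 this)
      have hsum0 : pullSum x y k (x k) = 0 := by rw [← h.mean_mul, h0]; simp
      refine ⟨rfl, rfl, fun v => ?_, fun v => ?_, ?_, fun _ => hfar⟩
      · by_cases hv : v = x k
        · subst hv; simp [ZoomState.activate, h0]
        · simp [ZoomState.activate, hv, h.count_eq]
      · by_cases hv : v = x k
        · subst hv; simp [h0, hsum0]
        · simp [ZoomState.activate, hv, h.mean_mul]
      · rw [h0]
        linarith [(hμ01 xopt).2, (hμ01 (x k)).1]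
    · refine ⟨(Set.insert_eq_of_mem harm).symm, rfl, h.count_eq, h.mean_mul, ?_,
        fun h0 => absurd h0 (h.pulls_pos _ harm).ne'⟩
      have hn := h.pulls_pos _ harm
      -- Optimism: some active arm has index at least `μ xopt`. Either the ball of an active arm
      -- covers `xopt`, which costs one radius for distance and one for estimation, or an active arm
      -- is optimal.
      obtain ⟨v, hv, hle⟩ : ∃ v ∈ s'.arms, μ xopt ≤ s'.mean v + 2 * r (s'.count v) := by
        rcases h.optimal with h1 | ⟨v, hv, hvopt⟩
        · obtain ⟨v, hv, hball⟩ := Set.mem_iUnion₂.1 (hcov h1)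
          have hd := (hμ.dist_le_mul xopt v).trans
            (by simpa using Metric.mem_closedBall.1 hball : _ ≤ r (s'.count v))
          rw [Real.dist_eq] at hd
          have h2 := (abs_le.1 hd).2
          have h3 := (abs_le.1 (h.abs_mean_sub_le hconf hv)).1
          exact ⟨v, hv, by linarith⟩
        · have h3 := (abs_le.1 (h.abs_mean_sub_le hconf hv)).1
          have h4 := hr0 (s'.count v)
          exact ⟨v, hv, by linarith⟩
      have h5 := hmax v hv
      have h6 := (abs_le.1 (h.abs_mean_sub_le hconf harm)).2
      rw [h.count_eq (x k)] at h5 h6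
      -- The selected arm has gap at most `3 * r n` before this pull; doubling turns this into `6 *
      -- r (n + 1)`.
      linarith [hdbl _ hn]
  obtain ⟨ha, hsp, hc, hm, hg, hfar⟩ := common
  have hpos : ∀ u, u ≠ x k → 0 < pulls x (k + 1) u → 0 < pulls x k u := fun u hu h1 => by
    rwa [pulls_succ_of_ne x k hu] at h1
  refine ⟨fun v => ?_, fun v => ?_, fun v hv => ?_, fun u hu => ?_, fun u v hu hv huv => ?_, ?_,
    fun v hv => ?_⟩
  · by_cases hv : v = x k
    · subst hv; simp [ZoomState.observe, hc, pulls_succ_self]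
    · simp [ZoomState.observe, hv, hc, pulls_succ_of_ne]
  · by_cases hv : v = x k
    · subst hv
      simp only [ZoomState.observe, Function.update_self, hc, hm, pulls_succ_self,
        pullSum_succ_self]
      push_cast
      have : (pulls x k (x k) : ℝ) + 1 ≠ 0 := by positivity
      field_simp
    · simp [ZoomState.observe, hv, hm, pulls_succ_of_ne, pullSum_succ_of_ne]
  · have hv' : v ∈ insert (x k) s.arms := ha ▸ hv
    by_cases hvk : v = x k
    · subst hvk; rw [pulls_succ_self]; omega
    · rw [pulls_succ_of_ne x k hvk]
      exact h.pulls_pos v (hv'.resolve_left hvk)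
  · by_cases huk : u = x k
    · left
      change u ∈ s'.arms
      rw [ha, huk]
      exact Set.mem_insert _ _
    · rw [pulls_succ_of_ne x k huk]
      rcases h.removed u (hpos u huk hu) with h1 | h1
      · left
        change u ∈ s'.arms
        rw [ha]
        exact Set.mem_insert_of_mem _ h1
      · right
        change Disjoint _ s'.space
        rwa [hsp]
  -- If `x k` is new, its distance from `w` exceeds the radius of `w`. Otherwise the old separation
  -- survives, since one more pull only shrinks the radius.
  · have hnew : ∀ w, w ≠ x k → 0 < pulls x k w →
        min (r (pulls x (k + 1) w)) (r (pulls x (k + 1) (x k))) < dist w (x k) := by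
      intro w hw hwp
      rw [pulls_succ_of_ne x k hw, pulls_succ_self]
      rcases Nat.eq_zero_or_pos (pulls x k (x k)) with h0 | h0
      · exact (min_le_left _ _).trans_lt (by rw [dist_comm]; exact hfar h0 w hwp)
      · exact (min_le_min_left _ (hanti _ h0)).trans_lt (h.separated w (x k) hwp h0 hw)
    by_cases huk : u = x k
    · subst huk
      rw [min_comm, dist_comm]
      exact hnew v huv.symm (hpos v huv.symm hv)
    · by_cases hvk : v = x k
      · subst hvk
        exact hnew u huv (hpos u huv hu)
      · rw [pulls_succ_of_ne x k huk, pulls_succ_of_ne x k hvk]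
        exact h.separated u v (hpos u huk hu) (hpos v hvk hv) huv
  · change xopt ∈ s'.space ∨ ∃ v ∈ s'.arms, μ v = μ xopt
    rw [hsp, ha]
    exact h.optimal.imp_right fun ⟨v, hv, hvo⟩ => ⟨v, Set.mem_insert_of_mem _ hv, hvo⟩
  · by_cases hvk : v = x k
    · subst hvk; rw [pulls_succ_self]; exact hg
    · rw [pulls_succ_of_ne x k hvk]
      exact h.gap_le v (hpos v hvk hv)

theorem zoomInvariant_of_round {H : ℕ} {σ : ℕ → ZoomState X}
    (hr : ∀ n, 0 < n → 0 < r n) (hr0 : ∀ n, 0 ≤ r n) (hr1 : 1 ≤ r 1)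
    (hanti : ∀ n, 0 < n → r (n + 1) ≤ r n) (hdbl : ∀ n, 0 < n → r n ≤ 2 * r (n + 1))
    (hμ : LipschitzWith 1 μ) (hμ01 : ∀ x, μ x ∈ Set.Icc (0 : ℝ) 1) (hopt : ∀ x, μ x ≤ μ xopt)
    (hconf : ∀ k < H, ∀ v, 0 < pulls x k v →
      |pullSum x y k v / pulls x k v - μ v| ≤ r (pulls x k v))
    (h0 : σ 0 = ZoomState.init X) (hσ : ∀ k < H, ZoomState.Round r (σ k) (x k) (y k) (σ (k + 1))) :
    ∀ k ≤ H, ZoomInvariant r μ xopt x y k (σ k) := by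
  intro k hk
  induction k with
  | zero => rw [h0]; exact ZoomInvariant.init
  | succ k ih =>
    obtain ⟨s₁, s₂, hs₁, hs₂, hs₃⟩ := hσ k (by omega)
    rw [hs₃]
    exact ((ih (by omega)).removal hr hμ hopt (hconf k (by omega)) hs₁).pull_observe hr0 hr1
      hanti hdbl hμ hμ01 (hconf k (by omega)) hs₂

end Zooming

/-! ### Regret of Robust Zooming from its invariants and the covering bound -/

section ZoomingRegret

variable {X : Type*} [MetricSpace X]

/-- No ball of radius `ρ / 2` can contain two points at distance greater than `ρ`. -/
theorem HasCoveringBound.card_le {d κ : ℝ} (h : HasCoveringBound X d κ) (hκ : 0 < κ) {ρ : ℝ}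
    (hρ : 0 < ρ) (hρ1 : ρ ≤ 1) (V : Finset X)
    (hV : ∀ u ∈ V, ∀ v ∈ V, u ≠ v → ρ < dist u v) : (V.card : ℝ) ≤ κ * (ρ / 2) ^ (-d) := by
  set ε : ℝ≥0 := ⟨ρ / 2, by positivity⟩ with hε
  have hε0 : 0 < ε := by rw [← NNReal.coe_pos]; change 0 < ρ / 2; positivity
  have hε1 : ε ≤ 1 := by rw [← NNReal.coe_le_coe]; change ρ / 2 ≤ 1; linarith
  have h2ε : 2 * ε = ρ.toNNReal := by
    rw [← NNReal.coe_inj, Real.coe_toNNReal _ hρ.le]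
    change 2 * (ρ / 2) = ρ
    ring
  have hsep : Metric.IsSeparated ((2 * ε : ℝ≥0) : ℝ≥0∞) (V : Set X) := by
    intro u hu v hv huv
    rw [h2ε, edist_dist]
    exact (ENNReal.ofReal_lt_ofReal_iff (dist_pos.2 huv)).2 (hV u hu v hv huv)
  have h1 : (V : Set X).encard ≤ Metric.coveringNumber ε (Set.univ : Set X) :=
    (hsep.encard_le_packingNumber (Set.subset_univ _)).trans
      ((Metric.packingNumber_two_mul_le_externalCoveringNumber ε _).trans
        (Metric.externalCoveringNumber_le_coveringNumber ε _))
  have h2 := (ENat.toENNReal_le.2 h1).trans (h ε hε0 hε1)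
  rw [Set.encard_coe_eq_coe_finsetCard, ENat.toENNReal_coe, ← ENNReal.ofReal_natCast] at h2
  exact (ENNReal.ofReal_le_ofReal_iff (by positivity)).1 h2

/-- Split the arms by their final radius. Those below `ρ` cost at most `6 * ρ` per pull. Those of
radius at least `ρ` are pairwise `ρ`-separated, hence few; an arm with `n` pulls costs `6 * (√(L *
n) + w)`, and Cauchy–Schwarz sums the roots. -/
theorem sum_gap_le {d κ : ℝ} (hX : HasCoveringBound X d κ) (hκ : 0 < κ)
    {r : ℕ → ℝ} {L w : ℝ} (hL : 0 ≤ L) (hw : 0 ≤ w)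
    (hr : ∀ n : ℕ, r n = √(L / n) + w / n)
    {μ : X → ℝ} {xopt : X} {x : ℕ → X} {y : ℕ → ℝ} {H : ℕ} {s : ZoomState X}
    (h : ZoomInvariant r μ xopt x y H s) {ρ : ℝ} (hρ : 0 < ρ) (hρ1 : ρ ≤ 1) :
    ∑ t ∈ Finset.range H, (μ xopt - μ (x t)) ≤
      6 * (ρ * H + √(L * (κ * (ρ / 2) ^ (-d)) * H) + κ * (ρ / 2) ^ (-d) * w) := by
  classical
  set K := κ * (ρ / 2) ^ (-d) with hK
  set V := (Finset.range H).image x with hV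
  have hpos : ∀ v ∈ V, 0 < pulls x H v := by
    intro v hv
    obtain ⟨t, ht, rfl⟩ := Finset.mem_image.1 hv
    exact Finset.card_pos.2 ⟨t, by simpa using ht⟩
  have hsum : ∑ v ∈ V, (pulls x H v : ℝ) = H := by
    have := Finset.sum_comp (s := Finset.range H) (fun _ : X => (1 : ℝ)) x
    simp only [Finset.sum_const, Finset.card_range, nsmul_eq_mul, mul_one] at this
    rw [this]
    exact Finset.sum_congr rfl fun v _ => by simp [pulls]
  have hterm : ∀ v ∈ V, pulls x H v * r (pulls x H v) = √(L * pulls x H v) + w := by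
    intro v hv
    have hp : (0 : ℝ) < pulls x H v := by exact_mod_cast hpos v hv
    rw [hr, mul_add, mul_div_cancel₀ _ hp.ne']
    congr 1
    rw [show L * (pulls x H v : ℝ) = (pulls x H v : ℝ) ^ 2 * (L / pulls x H v) by field_simp,
      Real.sqrt_mul (by positivity), Real.sqrt_sq hp.le]
  set V₁ := V.filter fun v => ρ ≤ r (pulls x H v) with hV₁
  have hcard : (V₁.card : ℝ) ≤ K := by
    refine hX.card_le hκ hρ hρ1 V₁ fun u hu v hv huv => ?_
    rw [hV₁, Finset.mem_filter] at hu hv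
    exact (le_min hu.2 hv.2).trans_lt (h.separated u v (hpos u hu.1) (hpos v hv.1) huv)
  have hK0 : 0 ≤ K := le_trans (Nat.cast_nonneg _) hcard
  have hcs : ∑ v ∈ V₁, √(L * pulls x H v) ≤ √(L * K * H) := by
    refine Real.le_sqrt_of_sq_le ?_
    calc (∑ v ∈ V₁, √(L * pulls x H v)) ^ 2
        ≤ V₁.card * ∑ v ∈ V₁, √(L * pulls x H v) ^ 2 := sq_sum_le_card_mul_sum_sq
      _ = V₁.card * (L * ∑ v ∈ V₁, (pulls x H v : ℝ)) := by
          congr 1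
          rw [Finset.mul_sum]
          exact Finset.sum_congr rfl fun v _ => Real.sq_sqrt (by positivity)
      _ ≤ K * (L * H) := by
          refine mul_le_mul hcard (mul_le_mul_of_nonneg_left ?_ hL) ?_ hK0
          · rw [← hsum]
            exact Finset.sum_le_sum_of_subset_of_nonneg (Finset.filter_subset _ _)
              fun _ _ _ => Nat.cast_nonneg _
          · exact mul_nonneg hL (Finset.sum_nonneg fun _ _ => Nat.cast_nonneg _)
      _ = L * K * H := by ring
  calc ∑ t ∈ Finset.range H, (μ xopt - μ (x t))
      = ∑ v ∈ V, pulls x H v * (μ xopt - μ v) := by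
        have := Finset.sum_comp (s := Finset.range H) (fun v : X => μ xopt - μ v) x
        rw [this]
        exact Finset.sum_congr rfl fun v _ => by simp [pulls]
    _ ≤ ∑ v ∈ V, (6 * (ρ * pulls x H v) +
          if ρ ≤ r (pulls x H v) then 6 * (√(L * pulls x H v) + w) else 0) := by
        refine Finset.sum_le_sum fun v hv => ?_
        have h1 := mul_le_mul_of_nonneg_left (h.gap_le v (hpos v hv))
          (Nat.cast_nonneg (α := ℝ) (pulls x H v))
        have h2 := hterm v hv
        have h3 : 0 ≤ ρ * pulls x H v := by positivity
        split_ifs with hif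
        · linarith
        · have := mul_le_mul_of_nonneg_right (not_le.1 hif).le
            (Nat.cast_nonneg (α := ℝ) (pulls x H v))
          linarith
    _ = 6 * (ρ * H) + 6 * (∑ v ∈ V₁, √(L * pulls x H v) + V₁.card * w) := by
        rw [Finset.sum_add_distrib, ← Finset.mul_sum, ← Finset.mul_sum, hsum, ← Finset.sum_filter,
          ← Finset.mul_sum, Finset.sum_add_distrib, Finset.sum_const, nsmul_eq_mul]
    _ ≤ 6 * (ρ * H) + 6 * (√(L * K * H) + K * w) := by gcongr
    _ = _ := by ring

/-- The scale `ρ` is the smallest at which `ρ * H` dominates the other two terms: the first entry of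
the maximum gives `1 ≤ ρ ^ (d + 2) * H`, the second `w ≤ ρ ^ (d + 1) * H`. If `ρ` exceeds 1, the
covering bound is unavailable, but then the trivial bound `H` suffices. -/
theorem sum_gap_le_max {d κ : ℝ} (hd : 0 ≤ d) (hX : HasCoveringBound X d κ) (hκ : 0 < κ)
    {r : ℕ → ℝ} {L w : ℝ} (hL : 0 ≤ L) (hw : 0 ≤ w)
    (hr : ∀ n : ℕ, r n = √(L / n) + w / n)
    {μ : X → ℝ} (hμ01 : ∀ x, μ x ∈ Set.Icc (0 : ℝ) 1)
    {xopt : X} {x : ℕ → X} {y : ℕ → ℝ} {H : ℕ} (hH : 0 < H) {s : ZoomState X}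
    (h : ZoomInvariant r μ xopt x y H s) :
    ∑ t ∈ Finset.range H, (μ xopt - μ (x t)) ≤
      6 * (1 + √(L * (κ * 2 ^ d)) + κ * 2 ^ d) *
        (H * max ((H : ℝ) ^ (-(1 / (d + 2)))) ((w / H) ^ (1 / (d + 1)))) := by
  have hH' : (0 : ℝ) < H := by exact_mod_cast hH
  set ρ := max ((H : ℝ) ^ (-(1 / (d + 2)))) ((w / H) ^ (1 / (d + 1))) with hρdef
  have hρ1 : (H : ℝ) ^ (-(1 / (d + 2))) ≤ ρ := le_max_left _ _
  have hρ2 : (w / H) ^ (1 / (d + 1)) ≤ ρ := le_max_right _ _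
  have hρ : 0 < ρ := (Real.rpow_pos_of_pos hH' _).trans_le hρ1
  have hK1 : 0 < κ * 2 ^ d := by positivity
  set K₁ := κ * (2 : ℝ) ^ d with hK₁
  rcases le_or_gt ρ 1 with hle | hgt
  · refine (sum_gap_le hX hκ hL hw hr h hρ hle).trans ?_
    have hK : κ * (ρ / 2) ^ (-d) = K₁ * ρ ^ (-d) := by
      rw [Real.div_rpow hρ.le (by norm_num), Real.rpow_neg (by norm_num : (0 : ℝ) ≤ 2)]
      rw [div_inv_eq_mul]; ring
    have hA : ρ ^ (-d) ≤ ρ ^ 2 * H := by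
      have h1 : (H : ℝ)⁻¹ ≤ ρ ^ (d + 2) := by
        calc (H : ℝ)⁻¹ = ((H : ℝ) ^ (-(1 / (d + 2)))) ^ (d + 2) := by
              rw [← Real.rpow_mul hH'.le, ← Real.rpow_neg_one]
              congr 1; field_simp
          _ ≤ _ := Real.rpow_le_rpow (by positivity) hρ1 (by positivity)
      have h2 : 1 ≤ ρ ^ (d + 2) * H := by
        have := mul_le_mul_of_nonneg_right h1 hH'.le
        rwa [inv_mul_cancel₀ hH'.ne'] at this
      have h3 : ρ ^ (-d) * (ρ ^ (d + 2) * H) = ρ ^ 2 * H := by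
        rw [← mul_assoc, ← Real.rpow_add hρ]
        norm_num
      have := mul_le_mul_of_nonneg_left h2 (Real.rpow_nonneg hρ.le (-d))
      rwa [h3, mul_one] at this
    have hB : ρ ^ (-d) * w ≤ ρ * H := by
      have h1 : w / H ≤ ρ ^ (d + 1) := by
        calc w / H = ((w / H) ^ (1 / (d + 1))) ^ (d + 1) := by
              rw [← Real.rpow_mul (by positivity)]
              rw [one_div_mul_cancel (by positivity), Real.rpow_one]
          _ ≤ _ := Real.rpow_le_rpow (by positivity) hρ2 (by positivity)
      have h2 : w ≤ ρ ^ (d + 1) * H := (div_le_iff₀ hH').1 h1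
      have h3 : ρ ^ (-d) * (ρ ^ (d + 1) * H) = ρ * H := by
        rw [← mul_assoc, ← Real.rpow_add hρ]
        norm_num
      have := mul_le_mul_of_nonneg_left h2 (Real.rpow_nonneg hρ.le (-d))
      rwa [h3] at this
    have hC : √(L * (K₁ * ρ ^ (-d)) * H) ≤ √(L * K₁) * (H * ρ) := by
      refine (Real.sqrt_le_sqrt (?_ : _ ≤ L * K₁ * (H * ρ) ^ 2)).trans_eq ?_
      · have := mul_le_mul_of_nonneg_left hA (by positivity : 0 ≤ L * K₁ * H)
        linarith
      · rw [Real.sqrt_mul (by positivity), Real.sqrt_sq (by positivity)]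
    have hB' := mul_le_mul_of_nonneg_left hB hK1.le
    rw [hK]
    linarith
  · calc ∑ t ∈ Finset.range H, (μ xopt - μ (x t)) ≤ ∑ t ∈ Finset.range H, (1 : ℝ) :=
          Finset.sum_le_sum fun t _ => by linarith [(hμ01 xopt).2, (hμ01 (x t)).1]
      _ = 1 * (H * 1) := by simp
      _ ≤ _ := by
          gcongr
          have := Real.sqrt_nonneg (L * K₁)
          linarith

/-- The confidence radius of Robust Zooming satisfies the assumptions of
`zoomInvariant_of_round`. -/
theorem zoomInvariant_of_round_radius {H T : ℕ} {δ w : ℝ} {σ : ℕ → ZoomState X}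
    {μ : X → ℝ} {xopt : X} {x : ℕ → X} {y : ℕ → ℝ} (hw : 1 ≤ w)
    (hL : 0 ≤ 4 * Real.log T + 2 * Real.log (2 / δ))
    (hμ : LipschitzWith 1 μ) (hμ01 : ∀ x, μ x ∈ Set.Icc (0 : ℝ) 1) (hopt : ∀ x, μ x ≤ μ xopt)
    (hconf : ∀ k < H, ∀ v, 0 < pulls x k v →
      |pullSum x y k v / pulls x k v - μ v| ≤ radius T δ w (pulls x k v))
    (h0 : σ 0 = ZoomState.init X)
    (hσ : ∀ k < H, ZoomState.Round (radius T δ w) (σ k) (x k) (y k) (σ (k + 1))) :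
    ZoomInvariant (radius T δ w) μ xopt x y H (σ H) := by
  set L := 4 * Real.log T + 2 * Real.log (2 / δ) with hLdef
  have hr : ∀ n : ℕ, radius T δ w n = √(L / n) + w / n := fun n => rfl
  refine zoomInvariant_of_round (fun n hn => ?_) (fun n => ?_) ?_ (fun n hn => ?_)
    (fun n hn => ?_) hμ hμ01 hopt hconf h0 hσ H le_rfl
  · rw [hr]; positivity
  · rw [hr]; positivity
  -- Here `1 ≤ w` matters: after its first pull an arm has radius at least 1, which bounds any gap.
  · rw [hr]
    have := Real.sqrt_nonneg (L / (1 : ℕ))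
    simp only [Nat.cast_one, div_one] at *
    linarith
  · rw [hr, hr]
    have : (n : ℝ) ≤ (n + 1 : ℕ) := by push_cast; linarith
    have hn' : (0 : ℝ) < n := by exact_mod_cast hn
    gcongr
  · rw [hr, hr]
    have hn' : (1 : ℝ) ≤ n := by exact_mod_cast hn
    have h1 : (1 : ℝ) / n ≤ 2 * (1 / (n + 1 : ℕ)) := by
      push_cast
      rw [mul_one_div, div_le_div_iff₀ (by positivity) (by positivity)]
      linarith
    have h2 : √(L / n) ≤ 2 * √(L / (n + 1 : ℕ)) := by
      refine Real.sqrt_le_iff.2 ⟨by positivity, ?_⟩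
      rw [mul_pow, Real.sq_sqrt (by positivity)]
      have h4 : 0 ≤ L / (n + 1 : ℕ) := by positivity
      have := mul_le_mul_of_nonneg_left h1 hL
      have e1 : L * (1 / n) = L / n := by ring
      have e2 : L * (2 * (1 / (n + 1 : ℕ))) = 2 * (L / (n + 1 : ℕ)) := by ring
      linarith
    have h3 : w / n ≤ 2 * (w / (n + 1 : ℕ)) := by
      have := mul_le_mul_of_nonneg_left h1 (by linarith : 0 ≤ w)
      have e1 : w * (1 / n) = w / n := by ring
      have e2 : w * (2 * (1 / (n + 1 : ℕ))) = 2 * (w / (n + 1 : ℕ)) := by ring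
      linarith
    linarith

end ZoomingRegret

/-! ### The EXP3.P inequality along a path -/

section Exp3

variable {N : ℕ}

theorem exp3Prob_ge {γ : ℝ} (hγ : γ ≤ 1) {w : Fin N → ℝ} (hw : ∀ j, 0 < w j) (j : Fin N) :
    γ / N ≤ exp3Prob γ w j := by
  have : 0 ≤ w j / ∑ k, w k := div_nonneg (hw j).le (Finset.sum_nonneg fun k _ => (hw k).le)
  have h1 : 0 ≤ 1 - γ := by linarith
  have := mul_nonneg h1 this
  unfold exp3Prob
  linarith

theorem sum_exp3Prob [NeZero N] (γ : ℝ) {w : Fin N → ℝ} (hw : ∀ j, 0 < w j) :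
    ∑ j, exp3Prob γ w j = 1 := by
  have hN : (N : ℝ) ≠ 0 := by exact_mod_cast NeZero.ne N
  have hW : 0 < ∑ k, w k := Finset.sum_pos (fun k _ => hw k) Finset.univ_nonempty
  simp only [exp3Prob, Finset.sum_add_distrib, ← Finset.mul_sum, ← Finset.sum_div,
    div_self hW.ne', Finset.sum_const, Finset.card_univ, Fintype.card_fin, nsmul_eq_mul]
  field_simp
  ring

theorem exp3Prob_pos {γ : ℝ} (hγ0 : 0 < γ) (hγ : γ ≤ 1) {w : Fin N → ℝ} (hw : ∀ j, 0 < w j)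
    (j : Fin N) : 0 < exp3Prob γ w j := by
  have : (0 : ℝ) < N := by exact_mod_cast j.pos
  exact (div_pos hγ0 this).trans_le (exp3Prob_ge hγ hw j)

theorem exp3Prob_le_one {γ : ℝ} (hγ0 : 0 < γ) (hγ : γ ≤ 1) {w : Fin N → ℝ} (hw : ∀ j, 0 < w j)
    (j : Fin N) : exp3Prob γ w j ≤ 1 := by
  have : NeZero N := ⟨j.pos.ne'⟩
  rw [← sum_exp3Prob γ hw]
  exact Finset.single_le_sum (fun k _ => (exp3Prob_pos hγ0 hγ hw k).le) (Finset.mem_univ j)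

theorem exp3Weight_pos (M : ℕ) (α γ : ℝ) (i : ℕ → Fin N) (g : ℕ → ℝ) (b : ℕ) (j : Fin N) :
    0 < exp3Weight M α γ i g b j := by
  induction b generalizing j with
  | zero => simp [exp3Weight]
  | succ b ih => exact mul_pos (ih j) (Real.exp_pos _)

/-- The potential is the logarithm of the total weight. Its increment is estimated by `exp z ≤ 1 + z
+ z ^ 2`, valid since `γ / (3 * N)` over any probability is at most `1 / 3` and `β ≤ 2`. The
quadratic term is left as `1 / exp3Prob γ w i`, whose sum over the batches is controlled by a
separate event. -/
theorem exp3_step {γ β g : ℝ} (hγ0 : 0 < γ) (hγ : γ ≤ 3 / 5) (hβ0 : 0 ≤ β) (hβ : β ≤ 2)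
    (hg : |g| ≤ 1) {w : Fin N → ℝ} (hw : ∀ j, 0 < w j) (i : Fin N) :
    (1 - γ) * (Real.log (∑ j, w j * Real.exp (γ / (3 * N) *
        ((if i = j then g / exp3Prob γ w j else 0) + β / exp3Prob γ w j))) -
      Real.log (∑ j, w j)) ≤
      γ / (3 * N) * (g + N * β + 5 / 3 * (γ / N) * (1 / exp3Prob γ w i) + 2 / 3 * N * β ^ 2) := by
  have : NeZero N := ⟨i.pos.ne'⟩
  have hN : (0 : ℝ) < N := by exact_mod_cast i.pos
  have hγ1 : γ ≤ 1 := by linarith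
  set p := exp3Prob γ w with hp
  have hpos : ∀ j, 0 < p j := exp3Prob_pos hγ0 hγ1 hw
  have hge : ∀ j, γ / N ≤ p j := exp3Prob_ge hγ1 hw
  set ε := γ / (3 * N) with hε
  have hε0 : 0 < ε := by positivity
  have hW : 0 < ∑ k, w k := Finset.sum_pos (fun k _ => hw k) Finset.univ_nonempty
  have hinv : ∀ j, ε * (1 / p j) ≤ 1 / 3 := by
    intro j
    rw [mul_one_div, div_le_iff₀ (hpos j)]
    have := hge j
    have e : ε = 1 / 3 * (γ / N) := by rw [hε]; field_simp
    rw [e]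
    exact mul_le_mul_of_nonneg_left this (by norm_num)
  set h : Fin N → ℝ := fun j => if i = j then g / p j else 0 with hh
  set z : Fin N → ℝ := fun j => ε * (h j + β / p j) with hz
  have hh_abs : ∀ j, |h j| ≤ 1 / p j := by
    intro j
    simp only [hh]
    split_ifs
    · rw [abs_div, abs_of_pos (hpos j)]
      exact div_le_div_of_nonneg_right hg (hpos j).le
    · rw [abs_zero]; exact (one_div_pos.2 (hpos j)).le
  have hz1 : ∀ j, |z j| ≤ 1 := by
    intro j
    have h1 := abs_le.1 (hh_abs j)
    have h2 := hinv j
    have h3 : 0 < ε * (1 / p j) := mul_pos hε0 (one_div_pos.2 (hpos j))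
    have e1 : ε * (β / p j) = β * (ε * (1 / p j)) := by ring
    have h4 : ε * (β / p j) ≤ 2 * (1 / 3) := by
      rw [e1]; exact mul_le_mul hβ h2 h3.le (by norm_num)
    have h5 : 0 ≤ ε * (β / p j) := by rw [e1]; exact mul_nonneg hβ0 h3.le
    have h6 := mul_le_mul_of_nonneg_left h1.1 hε0.le
    have h7 := mul_le_mul_of_nonneg_left h1.2 hε0.le
    rw [abs_le]
    simp only [hz, mul_add]
    constructor <;> linarith
  have hexp : ∀ j, Real.exp (z j) ≤ 1 + z j + z j ^ 2 := fun j => by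
    have := (abs_le.1 (Real.abs_exp_sub_one_sub_id_le (hz1 j))).2
    linarith
  have ha : ∀ j, (1 - γ) * (w j / ∑ k, w k) = p j - γ / N := fun j => by
    simp only [hp, exp3Prob]; ring
  have hlog : Real.log (∑ j, w j * Real.exp (z j)) - Real.log (∑ j, w j) ≤
      ∑ j, (w j / ∑ k, w k) * (z j + z j ^ 2) := by
    have hW' : 0 < ∑ j, w j * Real.exp (z j) :=
      Finset.sum_pos (fun k _ => mul_pos (hw k) (Real.exp_pos _)) Finset.univ_nonempty
    rw [← Real.log_div hW'.ne' hW.ne']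
    refine (Real.log_le_sub_one_of_pos (div_pos hW' hW)).trans ?_
    rw [sub_le_iff_le_add]
    calc (∑ j, w j * Real.exp (z j)) / ∑ k, w k
        ≤ (∑ j, w j * (1 + z j + z j ^ 2)) / ∑ k, w k := by
          refine div_le_div_of_nonneg_right ?_ hW.le
          exact Finset.sum_le_sum fun j _ => mul_le_mul_of_nonneg_left (hexp j) (hw j).le
      _ = ∑ j, ((w j / ∑ k, w k) * (z j + z j ^ 2) + w j / ∑ k, w k) := by
          rw [Finset.sum_div]
          exact Finset.sum_congr rfl fun j _ => by ring
      _ = _ := by rw [Finset.sum_add_distrib, ← Finset.sum_div, div_self hW.ne']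
  have hsum_h : ∑ j, p j * h j = g := by
    simp only [hh, mul_ite, mul_zero, Finset.sum_ite_eq, Finset.mem_univ, if_true]
    exact mul_div_cancel₀ _ (hpos i).ne'
  have hsum_h2 : ∑ j, p j * h j ^ 2 ≤ 1 / p i := by
    have : ∀ j, p j * h j ^ 2 = if i = j then g ^ 2 / p j else 0 := fun j => by
      simp only [hh]
      split_ifs
      · have := (hpos j).ne'; field_simp
      · simp
    simp only [this, Finset.sum_ite_eq, Finset.mem_univ, if_true]
    exact div_le_div_of_nonneg_right (by rw [← sq_abs]; exact pow_le_one₀ (abs_nonneg _) hg)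
      (hpos i).le
  have hsum_inv : ∑ j, 1 / p j ≤ N * (N / γ) := by
    calc ∑ j, 1 / p j ≤ ∑ _j : Fin N, (N / γ : ℝ) := by
          refine Finset.sum_le_sum fun j _ => ?_
          rw [← one_div_div γ]
          exact one_div_le_one_div_of_le (by positivity) (hge j)
      _ = _ := by simp
  have hlin : ∑ j, p j * z j = ε * (g + N * β) := by
    have : ∀ j, p j * z j = ε * (p j * h j + β) := fun j => by
      have := (hpos j).ne'
      simp only [hz]; field_simp
    simp only [this, ← Finset.mul_sum, Finset.sum_add_distrib, hsum_h]
    simp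
  -- The rewards may be negative, because of noise and corruption, so `∑ j, z j` need not be
  -- nonnegative. Only the drawn action can contribute a negative amount.
  have hneg : -∑ j, z j ≤ ε * (1 / p i) := by
    have h1 : ε * h i ≤ ∑ j, z j := by
      have h2 : ∀ j, ε * h j ≤ z j := fun j => by
        have : 0 ≤ β / p j := div_nonneg hβ0 (hpos j).le
        exact mul_le_mul_of_nonneg_left (by linarith) hε0.le
      calc ε * h i = ∑ j, ε * h j := by
            rw [Finset.sum_eq_single i]
            · intro j _ hj; simp [hh, hj.symm]
            · simp
        _ ≤ _ := Finset.sum_le_sum fun j _ => h2 j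
    have h3 := mul_le_mul_of_nonneg_left (abs_le.1 (hh_abs i)).1 hε0.le
    linarith
  have hquad : ∑ j, p j * z j ^ 2 ≤ 2 * ε ^ 2 * (1 / p i + β ^ 2 * (N * (N / γ))) := by
    calc ∑ j, p j * z j ^ 2 ≤ ∑ j, 2 * ε ^ 2 * (p j * h j ^ 2 + β ^ 2 * (1 / p j)) := by
          refine Finset.sum_le_sum fun j _ => ?_
          have e : p j * (2 * (h j ^ 2 + (β / p j) ^ 2)) =
              2 * (p j * h j ^ 2 + β ^ 2 * (1 / p j)) := by
            have := (hpos j).ne'; field_simp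
          have h1 : (h j + β / p j) ^ 2 ≤ 2 * (h j ^ 2 + (β / p j) ^ 2) := add_sq_le
          have h2 := mul_le_mul_of_nonneg_left h1 (mul_nonneg (sq_nonneg ε) (hpos j).le)
          simp only [hz, mul_pow]
          calc p j * (ε ^ 2 * (h j + β / p j) ^ 2) = ε ^ 2 * p j * (h j + β / p j) ^ 2 := by ring
            _ ≤ _ := h2
            _ = ε ^ 2 * (p j * (2 * (h j ^ 2 + (β / p j) ^ 2))) := by ring
            _ = _ := by rw [e]; ring
      _ = 2 * ε ^ 2 * (∑ j, p j * h j ^ 2 + β ^ 2 * ∑ j, 1 / p j) := by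
          rw [← Finset.mul_sum, Finset.sum_add_distrib, ← Finset.mul_sum]
      _ ≤ _ := by gcongr
  have hγ' : 0 ≤ 1 - γ := by linarith
  calc (1 - γ) * (Real.log (∑ j, w j * Real.exp (z j)) - Real.log (∑ j, w j))
      ≤ (1 - γ) * ∑ j, (w j / ∑ k, w k) * (z j + z j ^ 2) :=
        mul_le_mul_of_nonneg_left hlog hγ'
    _ = ∑ j, (p j - γ / N) * (z j + z j ^ 2) := by
        rw [Finset.mul_sum]
        exact Finset.sum_congr rfl fun j _ => by rw [← mul_assoc, ha]
    _ ≤ ∑ j, (p j * z j + γ / N * (-z j) + p j * z j ^ 2) := by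
        refine Finset.sum_le_sum fun j _ => ?_
        have := mul_nonneg (div_pos hγ0 hN).le (sq_nonneg (z j))
        linarith
    _ = ∑ j, p j * z j + γ / N * (-∑ j, z j) + ∑ j, p j * z j ^ 2 := by
        rw [Finset.sum_add_distrib, Finset.sum_add_distrib, ← Finset.mul_sum,
          Finset.sum_neg_distrib]
    _ ≤ ε * (g + N * β) + γ / N * (ε * (1 / p i)) +
          2 * ε ^ 2 * (1 / p i + β ^ 2 * (N * (N / γ))) := by
        rw [hlin]
        gcongr
    -- The two multiples of `1 / p i` combine to `5 / 3`: 1 from `hneg` and `2 / 3` from the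
    -- quadratic term.
    _ = _ := by
        have := (hpos i).ne'
        rw [hε]; field_simp; ring

/-- The regret bound of EXP3.P in terms of importance weighted rewards. -/
theorem exp3_sum_le {M m : ℕ} {α γ : ℝ} (hγ0 : 0 < γ) (hγ : γ ≤ 3 / 5)
    (hβ0 : 0 ≤ α / √((N : ℝ) * M)) (hβ : α / √((N : ℝ) * M) ≤ 2) (i : ℕ → Fin N) {g : ℕ → ℝ}
    (hg : ∀ b < m, |g b| ≤ 1) (j : Fin N) :
    (1 - γ) * ∑ b ∈ Finset.range m,
        ((if i b = j then g b / exp3Prob γ (exp3Weight M α γ i g b) j else 0) +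
          α / √((N : ℝ) * M) / exp3Prob γ (exp3Weight M α γ i g b) j) ≤
      ∑ b ∈ Finset.range m, g b + 3 * N * Real.log N / γ + m * (N * (α / √((N : ℝ) * M))) +
        5 / 3 * (γ / N) * ∑ b ∈ Finset.range m,
          1 / exp3Prob γ (exp3Weight M α γ i g b) (i b) +
        m * (2 / 3 * N * (α / √((N : ℝ) * M)) ^ 2) := by
  have : NeZero N := ⟨j.pos.ne'⟩
  have hN : (0 : ℝ) < N := by exact_mod_cast j.pos
  have hN1 : (1 : ℝ) ≤ N := by exact_mod_cast j.pos
  set β := α / √((N : ℝ) * M) with hβdef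
  set w := exp3Weight M α γ i g with hw
  have hwpos : ∀ b k, 0 < w b k := exp3Weight_pos M α γ i g
  have hstep : ∀ b k, w (b + 1) k = w b k * Real.exp (γ / (3 * N) *
      ((if i b = k then g b / exp3Prob γ (w b) k else 0) + β / exp3Prob γ (w b) k)) := by
    intro b k
    simp only [hw, exp3Weight, hβdef]
    rw [div_div, mul_comm (√((N : ℝ) * M))]
  have hupper : (1 - γ) * (Real.log (∑ k, w m k) - Real.log N) ≤
      ∑ b ∈ Finset.range m, γ / (3 * N) * (g b + N * β +
        5 / 3 * (γ / N) * (1 / exp3Prob γ (w b) (i b)) + 2 / 3 * N * β ^ 2) := by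
    have h0 : Real.log N = Real.log (∑ k, w 0 k) := by simp [hw, exp3Weight]
    rw [h0, ← Finset.sum_range_sub (fun b => Real.log (∑ k, w b k)), Finset.mul_sum]
    refine Finset.sum_le_sum fun b hb => ?_
    simp only [hstep b]
    exact exp3_step hγ0 hγ hβ0 hβ (hg b (Finset.mem_range.1 hb)) (hwpos b) (i b)
  -- The total weight is at least the weight of `j`, whose logarithm is exactly the scaled sum of
  -- its estimated rewards. The initial total weight is `N`, hence the term with `Real.log N`.
  have hlower : γ / (3 * N) * ∑ b ∈ Finset.range m,
      ((if i b = j then g b / exp3Prob γ (w b) j else 0) + β / exp3Prob γ (w b) j) ≤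
      Real.log (∑ k, w m k) := by
    have h1 : ∀ n, Real.log (w n j) = γ / (3 * N) * ∑ b ∈ Finset.range n,
        ((if i b = j then g b / exp3Prob γ (w b) j else 0) + β / exp3Prob γ (w b) j) := by
      intro n
      induction n with
      | zero => simp [hw, exp3Weight]
      | succ n ih =>
        rw [hstep, Real.log_mul (hwpos n j).ne' (Real.exp_pos _).ne', Real.log_exp, ih,
          Finset.sum_range_succ]
        ring
    rw [← h1]
    exact Real.log_le_log (hwpos m j)
      (Finset.single_le_sum (fun k _ => (hwpos m k).le) (Finset.mem_univ j))
  have hγ' : 0 ≤ 1 - γ := by linarith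
  have hlogN : 0 ≤ Real.log N := Real.log_nonneg hN1
  set S := ∑ b ∈ Finset.range m,
      ((if i b = j then g b / exp3Prob γ (w b) j else 0) + β / exp3Prob γ (w b) j)
  have h2 := mul_le_mul_of_nonneg_left hlower hγ'
  have h3 : (1 - γ) * Real.log N ≤ Real.log N := by nlinarith
  rw [← Finset.mul_sum] at hupper
  simp only [Finset.sum_add_distrib, Finset.sum_const, Finset.card_range, nsmul_eq_mul,
    ← Finset.mul_sum] at hupper
  have h4 : γ / (3 * N) * ((1 - γ) * S) ≤ γ / (3 * N) * (∑ b ∈ Finset.range m, g b +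
      m * (N * β) + 5 / 3 * (γ / N) * ∑ b ∈ Finset.range m, 1 / exp3Prob γ (w b) (i b) +
        m * (2 / 3 * N * β ^ 2) + 3 * N * Real.log N / γ) := by
    have e : γ / (3 * N) * (3 * N * Real.log N / γ) = Real.log N := by field_simp
    rw [mul_add, e]
    linarith
  have h5 := le_of_mul_le_mul_left h4 (by positivity)
  linarith

end Exp3

/-! ### The good event -/

section Events

variable {X Ω : Type*} [MetricSpace X] [MeasurableSpace X] [BorelSpace X]
  {mΩ : MeasurableSpace Ω} {P : Measure Ω} {ℱ : Filtration ℕ mΩ} {T H : ℕ} {δ : ℝ} {η c : ℕ → Ω → ℝ}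
  {i : ℕ → Ω → Fin (numBase T)} {x : ℕ → Ω → X} {μ : X → ℝ}

theorem gamma_le (N M : ℕ) : gamma N M ≤ 3 / 5 := min_le_left _ _

theorem gamma_pos {N M : ℕ} (hN : 2 ≤ N) (hM : 0 < M) : 0 < gamma N M := by
  have h1 : (1 : ℝ) < N := by exact_mod_cast hN
  have h2 : (0 : ℝ) < M := by exact_mod_cast hM
  have h3 := Real.log_pos h1
  unfold gamma
  positivity

theorem measurable_reward (hE : IsEnvironment P ℱ T η c)
    (hR : IsRun P ℱ T H δ i x (reward μ x η c)) (hμ : Continuous μ) {t : ℕ} (ht : t < T) :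
    Measurable[ℱ (2 * t + 2)] (reward μ x η c t) := by
  have h1 : Measurable[ℱ (2 * t + 2)] (x t) :=
    (hR.measurable_arm t ht).mono (ℱ.mono (by omega)) le_rfl
  exact ((hμ.measurable.comp h1).add (hE.measurable_noise t ht)).add (hE.measurable_corruption t ht)

theorem measurable_exp3Prob {m : MeasurableSpace Ω} {N : ℕ} {γ : ℝ} {w : Fin N → Ω → ℝ}
    (hw : ∀ j, Measurable[m] (w j)) (j : Fin N) :
    Measurable[m] fun ω => exp3Prob γ (fun k => w k ω) j := by
  unfold exp3Prob
  exact (((hw j).div (Finset.measurable_sum _ fun k _ => hw k)).const_mul _).add_const _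

/-- The weights at the start of a batch use only earlier draws and rewards. The last reward of batch
`b` is known at time `2 * ((b + 1) * H)`, exactly when the next draw takes place. -/
theorem measurable_masterWeight (hE : IsEnvironment P ℱ T η c)
    (hR : IsRun P ℱ T H δ i x (reward μ x η c)) (hμ : Continuous μ) (hH : 0 < H) (M : ℕ)
    (α γ : ℝ) (b : ℕ) (hb : b * H < T) (j : Fin (numBase T)) :
    Measurable[ℱ (2 * (b * H))] fun ω =>
      exp3Weight M α γ (fun k => i k ω) (batchReward T H δ fun t => reward μ x η c t ω) b j := by
  induction b generalizing j with
  | zero => exact measurable_const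
  | succ b ih =>
    have hb' : b * H < T := by nlinarith
    have hle : 2 * (b * H) + 1 ≤ 2 * ((b + 1) * H) := by nlinarith
    have hw : ∀ j, Measurable[ℱ (2 * ((b + 1) * H))] fun ω =>
        exp3Weight M α γ (fun k => i k ω) (batchReward T H δ fun t => reward μ x η c t ω) b j :=
      fun j => (ih hb' j).mono (ℱ.mono (by omega)) le_rfl
    have hp := measurable_exp3Prob (γ := γ) hw j
    have hg : Measurable[ℱ (2 * ((b + 1) * H))] fun ω =>
        batchReward T H δ (fun t => reward μ x η c t ω) b := by
      unfold batchReward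
      refine Measurable.div_const (Finset.measurable_sum _ fun t ht => ?_) _
      rw [Finset.mem_Ico] at ht
      exact (measurable_reward hE hR hμ (by omega)).mono (ℱ.mono (by omega)) le_rfl
    have hi : MeasurableSet[ℱ (2 * ((b + 1) * H))] {ω | i b ω = j} :=
      ℱ.mono hle _ (hR.measurable_base b hb' (measurableSet_singleton j))
    exact (hw j).mul (Real.measurable_exp.comp
      ((((Measurable.ite hi (hg.div hp) measurable_const).add
        (measurable_const.div (hp.mul_const _)))).const_mul _))

variable [IsProbabilityMeasure P]

theorem masterProb_ge (i : ℕ → Fin (numBase T))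
    (y : ℕ → ℝ) (b : ℕ) (j : Fin (numBase T)) :
    gamma (numBase T) (numBatch T H) / numBase T ≤ masterProb T H δ i y b j :=
  exp3Prob_ge (by linarith [gamma_le (numBase T) (numBatch T H)]) (exp3Weight_pos _ _ _ _ _ _) j

theorem masterProb_le_one (hN : 2 ≤ numBase T) (hM : 0 < numBatch T H) (i : ℕ → Fin (numBase T))
    (y : ℕ → ℝ) (b : ℕ) (j : Fin (numBase T)) : masterProb T H δ i y b j ≤ 1 :=
  exp3Prob_le_one (gamma_pos hN hM) (by linarith [gamma_le (numBase T) (numBatch T H)])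
    (exp3Weight_pos _ _ _ _ _ _) j

/-- A common form of the two concentration bounds for the master: each summand depends only on the
probability `q` of `j` and on whether `j` is drawn, and `hf` says that its exponential has
conditional mean at most 1. -/
theorem measure_le_sum_base_le (hE : IsEnvironment P ℱ T η c)
    (hR : IsRun P ℱ T H δ i x (reward μ x η c)) (hμ : Continuous μ) (hH : 0 < H)
    (hN : 2 ≤ numBase T) (hM : 0 < numBatch T H) (j : Fin (numBase T)) {f₁ f₀ : ℝ → ℝ}
    (hf₁ : Measurable f₁) (hf₀ : Measurable f₀)
    (hf : ∀ q, gamma (numBase T) (numBatch T H) / numBase T ≤ q → q ≤ 1 →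
      q * Real.exp (f₁ q) + (1 - q) * Real.exp (f₀ q) ≤ 1) {a : ℝ} :
    P {ω | a ≤ ∑ b ∈ Finset.range (T / H),
        if i b ω = j
        then f₁ (masterProb T H δ (fun k => i k ω) (fun t => reward μ x η c t ω) b j)
        else f₀ (masterProb T H δ (fun k => i k ω) (fun t => reward μ x η c t ω) b j)} ≤
      ENNReal.ofReal (Real.exp (-a)) := by
  have hlt : ∀ b < T / H, (b + 1) * H ≤ T := fun b hb =>
    (Nat.mul_le_mul_right H hb).trans (Nat.div_mul_le_self T H)
  have hlt' : ∀ b < T / H, b * H < T := fun b hb => by have := hlt b hb; nlinarith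
  set p : ℕ → Ω → ℝ := fun b ω =>
    masterProb T H δ (fun k => i k ω) (fun t => reward μ x η c t ω) b j with hp
  have hpm : ∀ b < T / H, Measurable[ℱ (2 * (b * H))] (p b) := fun b hb =>
    measurable_exp3Prob (measurable_masterWeight hE hR hμ hH _ _ _ b (hlt' b hb)) j
  have hset : ∀ b < T / H, MeasurableSet[ℱ (2 * (b * H) + 1)] (i b ⁻¹' {j}) := fun b hb =>
    hR.measurable_base b (hlt' b hb) (measurableSet_singleton j)
  have heq : ∀ b ω, (if i b ω = j then f₁ (p b ω) else f₀ (p b ω)) =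
      (i b ⁻¹' {j}).indicator (fun ω => f₁ (p b ω)) ω +
        (i b ⁻¹' {j})ᶜ.indicator (fun ω => f₀ (p b ω)) ω := by
    intro b ω
    by_cases h : i b ω = j <;> simp [h]
  refine measure_le_sum_le_exp_neg P (fun b => ℱ (2 * (b * H)))
    (fun b b' h => ℱ.mono (by gcongr)) (fun b => ℱ.le _) _ (T / H) (fun b hb => ?_)
    (fun b hb A hA => ?_) a
  · have hle : 2 * (b * H) + 1 ≤ 2 * ((b + 1) * H) := by nlinarith
    have hpm' : Measurable[ℱ (2 * ((b + 1) * H))] (p b) :=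
      (hpm b hb).mono (ℱ.mono (by omega)) le_rfl
    exact Measurable.ite (ℱ.mono hle _ (hset b hb)) (hf₁.comp hpm') (hf₀.comp hpm')
  · have hq : ∀ ω, gamma (numBase T) (numBatch T H) / numBase T ≤ p b ω ∧ p b ω ≤ 1 := fun ω =>
      ⟨masterProb_ge _ _ _ _, masterProb_le_one hN hM _ _ _ _⟩
    have hγ := gamma_pos hN hM
    refine (lintegral_congr fun ω => ?_).trans_le (setLIntegral_exp_ite_le (ℱ.le _) P (ℱ.le _ _ (hset b hb))
      (hR.law_base b (hlt' b hb) j) (hpm b hb)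
      (fun ω => le_trans (by positivity) (hq ω).1) (fun ω => (hq ω).2)
      (hf₁.comp (hpm b hb)) (hf₀.comp (hpm b hb)) (fun ω => hf _ (hq ω).1 (hq ω).2) hA)
    exact congrArg (fun z => ENNReal.ofReal (Real.exp z)) (heq b ω)

theorem exp_neg_le_one_sub_add_sq {z : ℝ} (hz : 0 ≤ z) : Real.exp (-z) ≤ 1 - z + z ^ 2 := by
  rcases le_or_gt z 1 with h | h
  · have := (abs_le.1 (Real.abs_exp_sub_one_sub_id_le (x := -z) (by rwa [abs_neg, abs_of_nonneg hz]))).2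
    rw [neg_sq] at this
    linarith
  · have : Real.exp (-z) ≤ 1 := Real.exp_le_one_iff.2 (by linarith)
    nlinarith

/-- The importance weighted number of choices of `j` is not much less than its mean. -/
theorem measure_le_sum_one_sub_le (hE : IsEnvironment P ℱ T η c)
    (hR : IsRun P ℱ T H δ i x (reward μ x η c)) (hμ : Continuous μ) (hH : 0 < H)
    (hN : 2 ≤ numBase T) (hM : 0 < numBatch T H) (j : Fin (numBase T)) {l : ℝ} (hl : 0 ≤ l)
    (a : ℝ) :
    P {ω | a ≤ ∑ b ∈ Finset.range (T / H), (l * (1 -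
        (if i b ω = j then
          1 / masterProb T H δ (fun k => i k ω) (fun t => reward μ x η c t ω) b j else 0) -
        l / masterProb T H δ (fun k => i k ω) (fun t => reward μ x η c t ω) b j))} ≤
      ENNReal.ofReal (Real.exp (-a)) := by
  have hγ := gamma_pos hN hM
  have h := measure_le_sum_base_le hE hR hμ hH hN hM j (f₁ := fun q => l * (1 - 1 / q - l / q))
    (f₀ := fun q => l * (1 - l / q)) (by fun_prop) (by fun_prop) (a := a) ?_
  · refine le_trans (measure_mono fun ω hω => ?_) h
    refine le_trans (Set.mem_ofPred_eq ▸ hω) (Finset.sum_le_sum fun b _ => le_of_eq ?_)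
    split_ifs <;> ring
  · intro q hq hq1
    have hq0 : 0 < q := lt_of_lt_of_le (by positivity) hq
    have h1 := exp_neg_le_one_sub_add_sq (z := l / q) (by positivity)
    have e1 : Real.exp (l * (1 - 1 / q - l / q)) =
        Real.exp (l * (1 - l / q)) * Real.exp (-(l / q)) := by
      rw [← Real.exp_add]; ring_nf
    -- The left side is at most `1 - l + l ^ 2 / q`. The correction `l / q` in each summand pays for
    -- this second-order term; with `l = β` it is the exploration bonus of EXP3.P.
    have h2 : q * Real.exp (-(l / q)) + (1 - q) ≤ Real.exp (-(l * (1 - l / q))) := by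
      refine le_trans ?_ (Real.add_one_le_exp _)
      have := mul_le_mul_of_nonneg_left h1 hq0.le
      have e : q * (1 - l / q + (l / q) ^ 2) = q - l + l ^ 2 / q := by field_simp
      have e' : -(l * (1 - l / q)) = -l + l ^ 2 / q := by ring
      linarith
    calc _ = Real.exp (l * (1 - l / q)) * (q * Real.exp (-(l / q)) + (1 - q)) := by
          simp only [e1]; ring
      _ ≤ Real.exp (l * (1 - l / q)) * Real.exp (-(l * (1 - l / q))) :=
          mul_le_mul_of_nonneg_left h2 (Real.exp_pos _).le
      _ = 1 := by rw [← Real.exp_add]; simp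

/-- The importance weighted number of choices of `j` is at most of the order of its mean. -/
theorem measure_le_sum_inv_le (hE : IsEnvironment P ℱ T η c)
    (hR : IsRun P ℱ T H δ i x (reward μ x η c)) (hμ : Continuous μ) (hH : 0 < H)
    (hN : 2 ≤ numBase T) (hM : 0 < numBatch T H) (j : Fin (numBase T)) (a : ℝ) :
    P {ω | a ≤ ∑ b ∈ Finset.range (T / H), gamma (numBase T) (numBatch T H) / numBase T *
        ((if i b ω = j then
          1 / masterProb T H δ (fun k => i k ω) (fun t => reward μ x η c t ω) b j else 0) - 2)} ≤
      ENNReal.ofReal (Real.exp (-a)) := by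
  have hγ := gamma_pos hN hM
  set l := gamma (numBase T) (numBatch T H) / numBase T with hl
  have hl0 : 0 < l := by positivity
  have h := measure_le_sum_base_le hE hR hμ hH hN hM j (f₁ := fun q => l * (1 / q - 2))
    (f₀ := fun _ => l * (0 - 2)) (by fun_prop) (by fun_prop) (a := a) ?_
  · refine le_trans (measure_mono fun ω hω => ?_) h
    refine le_trans (Set.mem_ofPred_eq ▸ hω) (Finset.sum_le_sum fun b _ => le_of_eq ?_)
    split_ifs <;> ring
  · intro q hq hq1
    have hq0 : 0 < q := hl0.trans_le hq
    have hz1 : l / q ≤ 1 := (div_le_one hq0).2 hq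
    have h1 := (abs_le.1 (Real.abs_exp_sub_one_sub_id_le (x := l / q)
      (by rwa [abs_of_nonneg (by positivity)]))).2
    have e1 : Real.exp (l * (1 / q - 2)) = Real.exp (-(2 * l)) * Real.exp (l / q) := by
      rw [← Real.exp_add]; ring_nf
    -- Since `q ≥ l`, the exponent is at most 1 and `exp (l / q) ≤ 1 + 2 * (l / q)`. This is where
    -- the forced exploration `γ / N` is used, and the source of the constant 2.
    have h2 : q * Real.exp (l / q) + (1 - q) ≤ Real.exp (2 * l) := by
      refine le_trans ?_ (Real.add_one_le_exp _)
      have h3 : q * Real.exp (l / q) ≤ q * (1 + l / q + l / q * 1) := by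
        refine mul_le_mul_of_nonneg_left ?_ hq0.le
        have h4 : (l / q) ^ 2 ≤ l / q * 1 := by
          rw [sq]; exact mul_le_mul_of_nonneg_left hz1 (by positivity)
        linarith
      have e : q * (1 + l / q + l / q * 1) = q + 2 * l := by field_simp; ring
      linarith
    calc _ = Real.exp (-(2 * l)) * (q * Real.exp (l / q) + (1 - q)) := by
          simp only [e1]; ring_nf
      _ ≤ Real.exp (-(2 * l)) * Real.exp (2 * l) :=
          mul_le_mul_of_nonneg_left h2 (Real.exp_pos _).le
      _ = 1 := by rw [← Real.exp_add]; simp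

/-- The noise of a batch. -/
theorem measure_batch_noise_le (hE : IsEnvironment P ℱ T η c) (hH : 0 < H) {b : ℕ}
    (hb : (b + 1) * H ≤ T) {a : ℝ} (ha : 0 ≤ a) :
    P {ω | √(2 * a * H) < |∑ t ∈ Finset.Ico (b * H) ((b + 1) * H), η t ω|} ≤
      ENNReal.ofReal (2 * Real.exp (-a)) := by
  classical
  refine le_trans (measure_mono fun ω hω => ?_) (hE.measure_sqrt_lt_abs_sum_le
    (B := fun t => {_ω | t ∈ Finset.Ico (b * H) ((b + 1) * H)}) (fun t _ => MeasurableSet.const _)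
    hH ha)
  have : ((Finset.range T).filter fun t => ω ∈ {_ω : Ω | t ∈ Finset.Ico (b * H) ((b + 1) * H)}) =
      Finset.Ico (b * H) ((b + 1) * H) := by
    ext t
    simp only [Finset.mem_filter, Finset.mem_range, Set.mem_ofPred_eq, Finset.mem_Ico]
    omega
  simp only [Set.mem_ofPred_eq] at this hω ⊢
  rw [this]
  refine ⟨?_, hω⟩
  rw [Nat.card_Ico, add_mul, one_mul]
  omega

variable [CompactSpace X]

open Classical in
/-- The noise of the first `n` pulls, from round `s` on, of the arm of round `s`. -/
theorem measure_arm_noise_le (hE : IsEnvironment P ℱ T η c)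
    (hR : IsRun P ℱ T H δ i x (reward μ x η c)) {s n : ℕ} (hs : s < T) (hn : 0 < n) {a : ℝ}
    (ha : 0 ≤ a) :
    P {ω | ∃ k ≤ T, ((Finset.Ico s k).filter fun t => x t ω = x s ω).card = n ∧
        √(2 * a * n) < |∑ t ∈ (Finset.Ico s k).filter fun t => x t ω = x s ω, η t ω|} ≤
      ENNReal.ofReal (2 * Real.exp (-a)) := by
  -- `B t` says that round `t` is among the first `n` pulls, from `s` on, of the arm of round `s`.
  -- This is decided once the arm of round `t` is chosen, before its noise is seen. Stopping at `n`
  -- pulls makes the event independent of `k`, so no union over `k` is needed.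
  obtain ⟨B, hBdef⟩ : ∃ B : ℕ → Set Ω, B = fun t => {ω | s ≤ t ∧ x t ω = x s ω ∧
    ((Finset.Ico s t).filter fun t => x t ω = x s ω).card < n} := ⟨_, rfl⟩
  have heq : ∀ t u, s ≤ u → t ≤ u → u < T →
      MeasurableSet[ℱ (2 * u + 1)] {ω | x t ω = x s ω} := by
    intro t u hsu htu hu
    exact (((hR.measurable_arm t (by omega)).mono (ℱ.mono (by omega)) le_rfl).prodMk
      ((hR.measurable_arm s hs).mono (ℱ.mono (by omega)) le_rfl)) measurableSet_diagonal
  have hB : ∀ t < T, MeasurableSet[ℱ (2 * t + 1)] (B t) := by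
    intro t ht
    by_cases hst : s ≤ t
    · have hcard : Measurable[ℱ (2 * t + 1)] fun ω =>
          ((Finset.Ico s t).filter fun t => x t ω = x s ω).card := by
        simp only [Finset.card_filter]
        refine Finset.measurable_sum _ fun t' ht' => ?_
        exact Measurable.ite (heq t' t hst (Finset.mem_Ico.1 ht').2.le ht) measurable_const
          measurable_const
      have h3 := (heq t t hst le_rfl ht).inter (hcard (measurableSet_Iio (a := n)))
      have : B t = {ω | x t ω = x s ω} ∩
          (fun ω => ((Finset.Ico s t).filter fun t => x t ω = x s ω).card) ⁻¹' Set.Iio n := by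
        ext ω; simp [hBdef, hst]
      rw [this]
      exact h3
    · have : B t = ∅ := by ext ω; simp [hBdef, hst]
      rw [this]; exact @MeasurableSet.empty _ (ℱ (2 * t + 1))
  refine le_trans (measure_mono fun ω hω => ?_) (hE.measure_sqrt_lt_abs_sum_le hB hn ha)
  obtain ⟨k, hk, hcard, hlt⟩ := hω
  have hset : ((Finset.range T).filter fun t => ω ∈ B t) =
      (Finset.Ico s k).filter fun t => x t ω = x s ω := by
    ext t
    simp only [Finset.mem_filter, Finset.mem_range, hBdef, Set.mem_ofPred_eq, Finset.mem_Ico]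
    constructor
    · rintro ⟨ht, hst, hxt, hc⟩
      refine ⟨⟨hst, ?_⟩, hxt⟩
      by_contra hkt
      have : (Finset.Ico s k).filter (fun t => x t ω = x s ω) ⊆
          (Finset.Ico s t).filter fun t => x t ω = x s ω :=
        Finset.filter_subset_filter _ (Finset.Ico_subset_Ico_right (by omega))
      have := Finset.card_le_card this
      omega
    · rintro ⟨⟨hst, htk⟩, hxt⟩
      refine ⟨by omega, hst, hxt, ?_⟩
      rw [← hcard]
      refine Finset.card_lt_card ⟨Finset.filter_subset_filter _
        (Finset.Ico_subset_Ico_right htk.le), fun hsub => ?_⟩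
      have := hsub (Finset.mem_filter.2 ⟨Finset.mem_Ico.2 ⟨hst, htk⟩, hxt⟩)
      simp at this
  simp only [Set.mem_ofPred_eq]
  rw [hset]
  exact ⟨hcard, hlt⟩

end Events

/-! ### A batch along a path of the good event -/

section Batch

variable {X : Type*} {T H : ℕ} {δ : ℝ} {μ : X → ℝ} {xopt : X}
  {x : ℕ → X} {η c : ℕ → ℝ}

open Classical in
-- The noise events are indexed by rounds rather than arms. Taking `s` to be the first pull of `v`
-- in the batch, the pulls of `v` from `s` on are exactly its pulls in the batch so far. Its
-- corruption there is at most the total corruption.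
theorem abs_pullSum_div_sub_le {a w : ℝ} (hw : ∑ t ∈ Finset.range T, |c t| ≤ w)
    (hconf : ∀ s < T, ∀ n, 0 < n → n ≤ T → ∀ k ≤ T,
      ((Finset.Ico s k).filter fun t => x t = x s).card = n →
      |∑ t ∈ (Finset.Ico s k).filter fun t => x t = x s, η t| ≤ √(2 * a * n))
    {t₀ k : ℕ} (hk : t₀ + k ≤ T) {v : X} (hv : 0 < pulls (fun t => x (t₀ + t)) k v) :
    |pullSum (fun t => x (t₀ + t)) (fun t => μ (x (t₀ + t)) + η (t₀ + t) + c (t₀ + t)) k v /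
        pulls (fun t => x (t₀ + t)) k v - μ v| ≤
      √(2 * a / pulls (fun t => x (t₀ + t)) k v) + w / pulls (fun t => x (t₀ + t)) k v := by
  set S := (Finset.range k).filter fun t => x (t₀ + t) = v with hS
  have hcard : pulls (fun t => x (t₀ + t)) k v = S.card := rfl
  rw [hcard] at hv ⊢
  set n := S.card with hn
  have hSne : S.Nonempty := Finset.card_pos.1 hv
  obtain ⟨k₀, hk₀, hmin⟩ := S.exists_min_image id hSne
  simp only [hS, Finset.mem_filter, Finset.mem_range, id] at hk₀ hmin
  have hnT : n ≤ T := by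
    have h1 : n ≤ (Finset.range k).card := Finset.card_filter_le _ _
    rw [Finset.card_range] at h1
    omega
  have himg : ((Finset.Ico (t₀ + k₀) (t₀ + k)).filter fun t => x t = x (t₀ + k₀)) =
      S.map (addLeftEmbedding t₀) := by
    ext t
    simp only [hS, Finset.mem_filter, Finset.mem_Ico, Finset.mem_map, Finset.mem_range,
      addLeftEmbedding_apply, hk₀.2]
    constructor
    · rintro ⟨⟨h1, h2⟩, h3⟩
      refine ⟨t - t₀, ⟨by omega, ?_⟩, by omega⟩
      rwa [Nat.add_sub_cancel' (by omega)]
    · rintro ⟨u, ⟨h1, h2⟩, rfl⟩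
      exact ⟨⟨Nat.add_le_add_left (hmin u ⟨h1, h2⟩) _, by omega⟩, h2⟩
  have hnoise : |∑ t ∈ S, η (t₀ + t)| ≤ √(2 * a * n) := by
    have := hconf (t₀ + k₀) (by omega) n hv hnT (t₀ + k) hk (by rw [himg, Finset.card_map])
    rwa [himg, Finset.sum_map] at this
  have hcorr : |∑ t ∈ S, c (t₀ + t)| ≤ w := by
    refine (Finset.abs_sum_le_sum_abs _ _).trans (le_trans ?_ hw)
    have : ∑ t ∈ S, |c (t₀ + t)| = ∑ t ∈ S.map (addLeftEmbedding t₀), |c t| := by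
      rw [Finset.sum_map]; rfl
    rw [this]
    refine Finset.sum_le_sum_of_subset_of_nonneg (fun t ht => ?_) fun _ _ _ => abs_nonneg _
    obtain ⟨u, hu, rfl⟩ := Finset.mem_map.1 ht
    simp only [hS, Finset.mem_filter, Finset.mem_range] at hu
    simp only [addLeftEmbedding_apply, Finset.mem_range]
    omega
  have hn' : (0 : ℝ) < n := by exact_mod_cast hv
  have hsum : pullSum (fun t => x (t₀ + t))
      (fun t => μ (x (t₀ + t)) + η (t₀ + t) + c (t₀ + t)) k v =
      n * μ v + ∑ t ∈ S, η (t₀ + t) + ∑ t ∈ S, c (t₀ + t) := by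
    have h1 : ∑ t ∈ S, μ (x (t₀ + t)) = n * μ v := by
      rw [Finset.sum_congr rfl (g := fun _ => μ v), Finset.sum_const, nsmul_eq_mul]
      intro t ht
      rw [(Finset.mem_filter.1 ht).2]
    rw [← h1, ← Finset.sum_add_distrib, ← Finset.sum_add_distrib]
    rfl
  have heq : pullSum (fun t => x (t₀ + t))
      (fun t => μ (x (t₀ + t)) + η (t₀ + t) + c (t₀ + t)) k v / n - μ v =
      (∑ t ∈ S, η (t₀ + t)) / n + (∑ t ∈ S, c (t₀ + t)) / n := by
    rw [hsum]; field_simp; ring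
  rw [heq]
  refine (abs_add_le _ _).trans (add_le_add ?_ ?_)
  · rw [abs_div, abs_of_pos hn']
    refine (div_le_div_of_nonneg_right hnoise hn'.le).trans_eq ?_
    rw [show 2 * a * (n : ℝ) = (n : ℝ) ^ 2 * (2 * a / n) by field_simp,
      Real.sqrt_mul (by positivity), Real.sqrt_sq hn'.le, mul_div_cancel_left₀ _ hn'.ne']
  · rw [abs_div, abs_of_pos hn']
    exact div_le_div_of_nonneg_right hcorr hn'.le

open Classical in
/-- The regret in a batch whose base algorithm has a sufficient corruption level. -/
theorem batch_gap_le [MetricSpace X] {d κ : ℝ} (hd : 0 ≤ d) (hX : HasCoveringBound X d κ) (hκ : 0 < κ)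
    (hμ : LipschitzWith 1 μ) (hμ01 : ∀ x, μ x ∈ Set.Icc (0 : ℝ) 1) (hopt : ∀ x, μ x ≤ μ xopt)
    {w : ℝ} (hw1 : 1 ≤ w) (hL : 0 ≤ 4 * Real.log T + 2 * Real.log (2 / δ))
    (hw : ∑ t ∈ Finset.range T, |c t| ≤ w)
    (hconf : ∀ s < T, ∀ n, 0 < n → n ≤ T → ∀ k ≤ T,
      ((Finset.Ico s k).filter fun t => x t = x s).card = n →
      |∑ t ∈ (Finset.Ico s k).filter fun t => x t = x s, η t| ≤
        √(2 * (2 * Real.log T + Real.log (2 / δ)) * n))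
    {b : ℕ} (hH : 0 < H) (hb : (b + 1) * H ≤ T) {s : ℕ → ZoomState X}
    (hs : ∀ t, b * H ≤ t → t < (b + 1) * H → ZoomState.Round (radius T δ w)
      (if H ∣ t then ZoomState.init X else s t) (x t) (μ (x t) + η t + c t) (s (t + 1))) :
    ∑ t ∈ Finset.Ico (b * H) ((b + 1) * H), (μ xopt - μ (x t)) ≤
      6 * (1 + √((4 * Real.log T + 2 * Real.log (2 / δ)) * (κ * 2 ^ d)) + κ * 2 ^ d) *
        (H * max ((H : ℝ) ^ (-(1 / (d + 2)))) ((w / H) ^ (1 / (d + 1)))) := by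
  set L := 4 * Real.log T + 2 * Real.log (2 / δ) with hLdef
  have hb' : b * H + H ≤ T := by rwa [add_mul, one_mul] at hb
  -- Rounds are renumbered from the start of the batch. The memory left by the preceding batch is
  -- replaced by the initial one, as the restart requires.
  have hinv : ZoomInvariant (radius T δ w) μ xopt (fun t => x (b * H + t))
      (fun t => μ (x (b * H + t)) + η (b * H + t) + c (b * H + t)) H
      ((fun k => if k = 0 then ZoomState.init X else s (b * H + k)) H) := by
    refine zoomInvariant_of_round_radius
      (σ := fun k => if k = 0 then ZoomState.init X else s (b * H + k)) hw1 hL hμ hμ01 hopt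
      (fun k hk v hv => ?_) rfl (fun k hk => ?_)
    · refine (abs_pullSum_div_sub_le hw hconf (by omega) hv).trans_eq ?_
      simp only [radius]
      congr 3
      ring
    · have h1 := hs (b * H + k) (by omega) (by rw [add_mul, one_mul]; omega)
      have h2 : H ∣ b * H + k ↔ k = 0 := by
        rw [Nat.dvd_add_right (Dvd.intro_left b rfl)]
        constructor
        · intro h; exact Nat.eq_zero_of_dvd_of_lt h hk
        · rintro rfl; exact dvd_zero _
      simp only [h2] at h1
      simpa [add_assoc] using h1
  have := sum_gap_le_max hd hX hκ hL (by linarith) (fun n => rfl) hμ01 hH hinv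
  rwa [Finset.sum_Ico_eq_sum_range, show (b + 1) * H - b * H = H by rw [add_mul, one_mul]; omega]

/-- The corruption in a batch. -/
theorem batch_corruption_le {d : ℝ} (hd : 0 ≤ d) (hc : ∀ t < T, |c t| ≤ 1) (hH : 0 < H) {b : ℕ}
    (hb : (b + 1) * H ≤ T) :
    |∑ t ∈ Finset.Ico (b * H) ((b + 1) * H), c t| ≤
      H * ((∑ t ∈ Finset.range T, |c t|) / H) ^ (1 / (d + 1)) ∧
    |∑ t ∈ Finset.Ico (b * H) ((b + 1) * H), c t| ≤ H := by
  have hH' : (0 : ℝ) < H := by exact_mod_cast hH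
  have hsub : Finset.Ico (b * H) ((b + 1) * H) ⊆ Finset.range T := fun t ht => by
    rw [Finset.mem_Ico] at ht
    exact Finset.mem_range.2 (by omega)
  set S := ∑ t ∈ Finset.Ico (b * H) ((b + 1) * H), |c t| with hS
  have h0 : |∑ t ∈ Finset.Ico (b * H) ((b + 1) * H), c t| ≤ S := Finset.abs_sum_le_sum_abs _ _
  have hSH : S ≤ H := by
    calc S ≤ ∑ t ∈ Finset.Ico (b * H) ((b + 1) * H), (1 : ℝ) :=
          Finset.sum_le_sum fun t ht => hc t (Finset.mem_range.1 (hsub ht))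
      _ = H := by
          rw [Finset.sum_const, Nat.card_Ico, add_mul, one_mul, Nat.add_sub_cancel_left]; simp
  have hSC : S ≤ ∑ t ∈ Finset.range T, |c t| :=
    Finset.sum_le_sum_of_subset_of_nonneg hsub fun _ _ _ => abs_nonneg _
  have hS0 : 0 ≤ S := Finset.sum_nonneg fun _ _ => abs_nonneg _
  refine ⟨h0.trans ?_, h0.trans hSH⟩
  -- As `S / H ≤ 1`, lowering the exponent from 1 to `1 / (d + 1)` only increases the power. This
  -- brings the corruption to the same form as the batch regret.
  calc S = H * (S / H) ^ (1 : ℝ) := by rw [Real.rpow_one]; field_simp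
    _ ≤ H * (S / H) ^ (1 / (d + 1)) := by
        refine mul_le_mul_of_nonneg_left ?_ hH'.le
        refine Real.rpow_le_rpow_of_exponent_ge' (by positivity) ((div_le_one hH').2 hSH)
          (by positivity) ?_
        rw [div_le_one (by positivity)]
        linarith
    _ ≤ _ := by gcongr

end Batch

/-! ### From batch regret to total regret through EXP3.P -/

section Path

theorem sum_range_mul_eq (f : ℕ → ℝ) (m H : ℕ) :
    ∑ t ∈ Finset.range (m * H), f t =
      ∑ b ∈ Finset.range m, ∑ t ∈ Finset.Ico (b * H) ((b + 1) * H), f t := by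
  induction m with
  | zero => simp
  | succ m ih =>
    rw [Finset.sum_range_succ, ← ih, Finset.range_eq_Ico, Finset.range_eq_Ico,
      Finset.sum_Ico_consecutive _ (Nat.zero_le _) (Nat.mul_le_mul_right H (Nat.le_succ m))]

/-- The regret of Bandit-over-Bandit Robust Zooming along a path on which the base algorithm `j`
has regret at most `R` in each of its batches. -/
theorem path_regret_le {X : Type*} {T H : ℕ} {δ : ℝ} {μ : X → ℝ} {xopt : X} {x : ℕ → X}
    {η c : ℕ → ℝ} {i : ℕ → Fin (numBase T)} (hμ01 : ∀ x, μ x ∈ Set.Icc (0 : ℝ) 1)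
    (hH : 0 < H) (hN : 2 ≤ numBase T) (hM : 0 < numBatch T H)
    {β γ ν R K a₁ a₂ : ℝ} (hγ : γ = gamma (numBase T) (numBatch T H))
    (hβ : β = alpha (numBase T) (numBatch T H) δ / √((numBase T : ℝ) * numBatch T H))
    (hβ0 : 0 < β) (hβ2 : β ≤ 2) (hν : ν = √(2 * H * Real.log (12 * T / (H * δ))))
    (hR0 : 0 ≤ R) (hK0 : 0 ≤ K) (ha₁ : 0 ≤ a₁) (ha₂ : 0 ≤ a₂) (j : Fin (numBase T))
    (hR : ∀ b < T / H, i b = j →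
      ∑ t ∈ Finset.Ico (b * H) ((b + 1) * H), (μ xopt - μ (x t)) ≤ R)
    (hη : ∀ b < T / H, |∑ t ∈ Finset.Ico (b * H) ((b + 1) * H), η t| ≤ ν)
    (hc : ∀ b < T / H, |∑ t ∈ Finset.Ico (b * H) ((b + 1) * H), c t| ≤ K ∧
      |∑ t ∈ Finset.Ico (b * H) ((b + 1) * H), c t| ≤ H)
    (h₁ : ∑ b ∈ Finset.range (T / H), (β * (1 -
        (if i b = j then
          1 / masterProb T H δ i (fun t => μ (x t) + η t + c t) b j else 0) -
        β / masterProb T H δ i (fun t => μ (x t) + η t + c t) b j)) ≤ a₁)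
    (h₂ : ∀ j, ∑ b ∈ Finset.range (T / H), γ / numBase T *
        ((if i b = j then
          1 / masterProb T H δ i (fun t => μ (x t) + η t + c t) b j else 0) - 2) ≤ a₂) :
    T * μ xopt - ∑ t ∈ Finset.range T, μ (x t) ≤
      H + (T / H : ℕ) * (R + 2 * ν + 2 * K) + (2 * H + ν) * (γ * (T / H : ℕ) + a₁ / β +
        3 * numBase T * Real.log (numBase T) / γ + (T / H : ℕ) * (numBase T * β) +
        5 / 3 * (2 * γ * (T / H : ℕ) + numBase T * a₂) +
        (T / H : ℕ) * (2 / 3 * numBase T * β ^ 2)) := by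
  set m := T / H with hm
  set y : ℕ → ℝ := fun t => μ (x t) + η t + c t with hy
  set p : ℕ → Fin (numBase T) → ℝ := fun b k => masterProb T H δ i y b k with hp
  set g := batchReward T H δ y with hg
  set Q := 2 * (H : ℝ) + ν with hQ
  have hH' : (0 : ℝ) < H := by exact_mod_cast hH
  have hν0 : 0 ≤ ν := by rw [hν]; positivity
  have hQ0 : 0 < Q := by positivity
  have hNpos : (0 : ℝ) < numBase T := by exact_mod_cast (by omega : 0 < numBase T)
  have hNlog : 0 ≤ Real.log (numBase T) := Real.log_natCast_nonneg (numBase T)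
  have hγ0 : 0 < γ := hγ ▸ gamma_pos hN hM
  have hγ1 : γ ≤ 3 / 5 := hγ ▸ gamma_le _ _
  have hmH : m * H ≤ T := Nat.div_mul_le_self T H
  have hTm : T ≤ m * H + H := by
    have := Nat.div_add_mod T H
    have h2 := Nat.mod_lt T hH
    rw [mul_comm, ← hm] at this
    omega
  have hTm' : (T : ℝ) ≤ m * H + H := by exact_mod_cast hTm
  have hlen : ∀ b, (Finset.Ico (b * H) ((b + 1) * H)).card = H := fun b => by
    rw [Nat.card_Ico, add_mul, one_mul, Nat.add_sub_cancel_left]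
  have hppos : ∀ b k, 0 < p b k := fun b k =>
    exp3Prob_pos (gamma_pos hN hM) (by linarith [gamma_le (numBase T) (numBatch T H)])
      (exp3Weight_pos _ _ _ _ _ _) k
  -- the observed reward of a batch
  have hQg : ∀ b, Q * g b = ∑ t ∈ Finset.Ico (b * H) ((b + 1) * H), μ (x t) +
      ∑ t ∈ Finset.Ico (b * H) ((b + 1) * H), η t +
      ∑ t ∈ Finset.Ico (b * H) ((b + 1) * H), c t := by
    intro b
    rw [← Finset.sum_add_distrib, ← Finset.sum_add_distrib, hg]
    unfold batchReward
    rw [← hν, mul_div_cancel₀ _ hQ0.ne']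
  have hμsum : ∀ b, 0 ≤ ∑ t ∈ Finset.Ico (b * H) ((b + 1) * H), μ (x t) ∧
      ∑ t ∈ Finset.Ico (b * H) ((b + 1) * H), μ (x t) ≤ H := by
    intro b
    refine ⟨Finset.sum_nonneg fun t _ => (hμ01 _).1, ?_⟩
    calc _ ≤ ∑ t ∈ Finset.Ico (b * H) ((b + 1) * H), (1 : ℝ) :=
          Finset.sum_le_sum fun t _ => (hμ01 _).2
      _ = H := by rw [Finset.sum_const, hlen]; simp
  have hg1 : ∀ b < m, |g b| ≤ 1 := by
    intro b hb
    have h1 := abs_le.1 (hη b hb)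
    have h2 := abs_le.1 (hc b hb).2
    have h3 := hQg b
    have h4 := hμsum b
    rw [abs_le]
    constructor
    · refine le_of_mul_le_mul_left ?_ hQ0
      rw [h3, hQ]; linarith
    · refine le_of_mul_le_mul_left ?_ hQ0
      rw [h3, hQ]; linarith
  have hsumQg : Q * ∑ b ∈ Finset.range m, g b ≤
      ∑ t ∈ Finset.range (m * H), μ (x t) + m * (ν + K) := by
    rw [Finset.mul_sum, sum_range_mul_eq]
    calc ∑ b ∈ Finset.range m, Q * g b
        ≤ ∑ b ∈ Finset.range m, (∑ t ∈ Finset.Ico (b * H) ((b + 1) * H), μ (x t) + (ν + K)) := by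
          refine Finset.sum_le_sum fun b hb => ?_
          have hb := Finset.mem_range.1 hb
          have h1 := abs_le.1 (hη b hb)
          have h2 := abs_le.1 (hc b hb).1
          rw [hQg]; linarith
      _ = _ := by rw [Finset.sum_add_distrib, Finset.sum_const, Finset.card_range, nsmul_eq_mul]
  -- The incomplete last batch is given up, at a cost of at most `H`.
  have hregret : T * μ xopt - ∑ t ∈ Finset.range T, μ (x t) ≤
      H + (m * (H * μ xopt) - ∑ t ∈ Finset.range (m * H), μ (x t)) := by
    have h1 : ∑ t ∈ Finset.range (m * H), μ (x t) ≤ ∑ t ∈ Finset.range T, μ (x t) :=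
      Finset.sum_le_sum_of_subset_of_nonneg
        (fun t ht => Finset.mem_range.2 ((Finset.mem_range.1 ht).trans_le hmH))
        fun t _ _ => (hμ01 _).1
    have h2 := mul_le_mul_of_nonneg_right hTm' (hμ01 xopt).1
    have h3 := mul_le_mul_of_nonneg_left (hμ01 xopt).2 hH'.le
    linarith
  set E := γ * m + a₁ / β + 3 * numBase T * Real.log (numBase T) / γ + m * (numBase T * β) +
        5 / 3 * (2 * γ * m + numBase T * a₂) + m * (2 / 3 * numBase T * β ^ 2) with hE
  have hE0 : 0 ≤ E := by positivity
  have hm0 : (0 : ℝ) ≤ m := Nat.cast_nonneg m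
  -- If the guaranteed reward per batch is negative, the allowance of `R + ν + K` per batch already
  -- exceeds the best possible reward.
  rcases lt_or_ge (H * μ xopt - (R + ν + K)) 0 with hneg | hnonneg
  · have h1 : 0 ≤ ∑ t ∈ Finset.range (m * H), μ (x t) :=
      Finset.sum_nonneg fun t _ => (hμ01 _).1
    have h2 := mul_le_mul_of_nonneg_left hneg.le hm0
    have h3 : 0 ≤ (m : ℝ) * (ν + K) := by positivity
    have h4 := mul_nonneg hQ0.le hE0
    linarith
  set v := (H * μ xopt - (R + ν + K)) / Q with hv
  have hv0 : 0 ≤ v := div_nonneg hnonneg hQ0.le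
  have hQv : Q * v = H * μ xopt - (R + ν + K) := mul_div_cancel₀ _ hQ0.ne'
  have hv1 : v ≤ 1 := by
    rw [hv, div_le_one hQ0]
    have := mul_le_mul_of_nonneg_left (hμ01 xopt).2 hH'.le
    linarith
  have hgv : ∀ b < m, i b = j → v ≤ g b := by
    intro b hb hij
    refine le_of_mul_le_mul_left ?_ hQ0
    have h1 := abs_le.1 (hη b hb)
    have h2 := abs_le.1 (hc b hb).1
    have h3 := hR b hb hij
    rw [Finset.sum_sub_distrib, Finset.sum_const, hlen, nsmul_eq_mul] at h3
    rw [hQv, hQg]; linarith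
  have hexp := exp3_sum_le (M := numBatch T H) (m := m) (α := alpha (numBase T) (numBatch T H) δ) hγ0 hγ1
    (by rw [← hβ]; exact hβ0.le) (by rwa [← hβ]) i hg1 j
  rw [← hβ] at hexp
  have hpeq : ∀ b k, exp3Prob γ (exp3Weight (numBatch T H) (alpha (numBase T) (numBatch T H) δ) γ i g b) k =
      p b k := fun b k => by rw [hγ, hp]; rfl
  simp only [hpeq] at hexp
  set Y := ∑ b ∈ Finset.range m, ((if i b = j then 1 / p b j else 0) + β / p b j) with hY
  have hYge : m - a₁ / β ≤ Y := by
    have e : ∑ b ∈ Finset.range m, (β * (1 - (if i b = j then 1 / p b j else 0) - β / p b j)) =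
        β * (m - Y) := by
      rw [← Finset.mul_sum, hY]
      congr 1
      have : ∀ b, 1 - (if i b = j then 1 / p b j else 0) - β / p b j =
          1 - ((if i b = j then 1 / p b j else 0) + β / p b j) := fun b => by ring
      simp only [this]
      rw [Finset.sum_sub_distrib]
      simp
    have h1' : β * (m - Y) ≤ a₁ := e ▸ h₁
    rw [mul_comm, ← le_div_iff₀ hβ0] at h1'
    linarith
  -- Besides `v ≤ g b` on the draws of `j`, this uses `v ≤ 1` to keep the bonus terms.
  have hSge : v * Y ≤ ∑ b ∈ Finset.range m,
      ((if i b = j then g b / p b j else 0) + β / p b j) := by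
    rw [hY, Finset.mul_sum]
    refine Finset.sum_le_sum fun b hb => ?_
    have h1 : 0 ≤ β / p b j := div_nonneg hβ0.le (hppos b j).le
    have h2 : v * (β / p b j) ≤ β / p b j := mul_le_of_le_one_left h1 hv1
    split_ifs with hij
    · have h3 := hgv b (Finset.mem_range.1 hb) hij
      have h4 : v * (1 / p b j) ≤ g b / p b j := by
        rw [mul_one_div]
        exact div_le_div_of_nonneg_right h3 (hppos b j).le
      linarith
    · linarith
  -- The inverse probabilities of the drawn actions regroup into the importance weighted counts of
  -- all actions, each bounded by `h₂`.
  have hU : γ / numBase T * ∑ b ∈ Finset.range m, 1 / p b (i b) ≤ 2 * γ * m + numBase T * a₂ := by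
    have e : ∑ b ∈ Finset.range m, 1 / p b (i b) =
        ∑ k, ∑ b ∈ Finset.range m, (if i b = k then 1 / p b k else 0) := by
      rw [Finset.sum_comm]
      exact Finset.sum_congr rfl fun b _ => by simp
    rw [e, Finset.mul_sum]
    calc _ ≤ ∑ _k : Fin (numBase T), (a₂ + 2 * (γ / numBase T) * m) := by
          refine Finset.sum_le_sum fun k _ => ?_
          have := h₂ k
          rw [← Finset.mul_sum, Finset.sum_sub_distrib, Finset.sum_const, Finset.card_range,
            nsmul_eq_mul] at this
          simp only [hp]
          linarith
      _ = _ := by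
          rw [Finset.sum_const, Finset.card_univ, Fintype.card_fin, nsmul_eq_mul]
          field_simp
          ring
  have hγ' : 0 ≤ 1 - γ := by linarith
  have hleft : v * m - γ * m - a₁ / β ≤ (1 - γ) * (v * Y) := by
    have h1 := mul_le_mul_of_nonneg_left (mul_le_mul_of_nonneg_left hYge hv0) hγ'
    have h2 : γ * (v * m) ≤ γ * (1 * m) := by gcongr
    have h3 : 0 ≤ a₁ / β := by positivity
    have h4 : (1 - γ) * v * (a₁ / β) ≤ 1 * (a₁ / β) := by
      refine mul_le_mul_of_nonneg_right ?_ h3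
      exact mul_le_one₀ (by linarith) hv0 hv1
    linarith
  have hfinal : v * m - E ≤ ∑ b ∈ Finset.range m, g b := by
    have := mul_le_mul_of_nonneg_left hSge hγ'
    rw [hE]
    linarith
  have h5 := mul_le_mul_of_nonneg_left hfinal hQ0.le
  have h6 : Q * (v * m - E) = m * (H * μ xopt - (R + ν + K)) - Q * E := by
    rw [← hQv]; ring
  linarith

end Path

/-! ### Orders of magnitude -/

section Magnitudes

theorem one_le_two_mul_log {T : ℕ} {δ : ℝ} (hT : 2 ≤ T) (hδ0 : 0 < δ) (hδ1 : δ < 1) :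
    1 ≤ 2 * Real.log (T / δ) := by
  have hT' : (2 : ℝ) ≤ T := by exact_mod_cast hT
  have h1 : Real.log 2 ≤ Real.log (T / δ) := by
    refine Real.log_le_log (by norm_num) ?_
    rw [le_div_iff₀ hδ0]
    nlinarith
  have := Real.log_two_gt_d9
  linarith

theorem numBase_le_self (T : ℕ) : numBase T ≤ T :=
  Nat.clog_le_of_le_pow Nat.lt_two_pow_self.le

theorem two_le_numBase {T : ℕ} (hT : 3 ≤ T) : 2 ≤ numBase T := by
  by_contra h
  have h1 : T ≤ 2 ^ numBase T := Nat.le_pow_clog (by norm_num) T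
  have h2 : 2 ^ numBase T ≤ 2 ^ 1 := Nat.pow_le_pow_right (by norm_num) (by omega)
  omega

theorem numBase_le_log {T : ℕ} (hT : 2 ≤ T) : (numBase T : ℝ) ≤ 1 + 2 * Real.log T := by
  have h1 : 2 ^ (numBase T - 1) < T := Nat.pow_pred_clog_lt_self (by norm_num) (by omega)
  have h2 : ((numBase T - 1 : ℕ) : ℝ) * Real.log 2 ≤ Real.log T := by
    rw [← Real.log_pow]
    refine Real.log_le_log (by positivity) ?_
    exact_mod_cast h1.le
  have h3 : (numBase T : ℝ) ≤ (numBase T - 1 : ℕ) + 1 := by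
    exact_mod_cast (by omega : numBase T ≤ numBase T - 1 + 1)
  have h4 := Real.log_two_gt_d9
  have h5 : (0 : ℝ) ≤ (numBase T - 1 : ℕ) := Nat.cast_nonneg _
  nlinarith

/-- The crude bound `log a ≤ a - 1` absorbs numerical factors, so that every logarithm in the
algorithm becomes a numerical multiple of `2 * log (T / δ)`, which is at least 1. -/
theorem log_mul_div_le {T : ℕ} {δ a b : ℝ} (hT : 2 ≤ T) (hδ0 : 0 < δ) (hδ1 : δ < 1) (ha : 1 ≤ a)
    (hb0 : 0 < b) (hb : b ≤ T ^ 2) : Real.log (a * b / δ) ≤ a * (2 * Real.log (T / δ)) := by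
  have hT' : (0 : ℝ) < T := by positivity
  have h1 := one_le_two_mul_log hT hδ0 hδ1
  have h2 : Real.log b ≤ 2 * Real.log T := by
    have := Real.log_le_log hb0 hb
    rwa [Real.log_pow, Nat.cast_ofNat] at this
  have h3 := Real.log_le_sub_one_of_pos (show 0 < a by linarith)
  have h4 := Real.log_neg hδ0 hδ1
  rw [Real.log_div (by positivity) hδ0.ne', Real.log_mul (by positivity) hb0.ne']
  rw [Real.log_div hT'.ne' hδ0.ne'] at h1 ⊢
  nlinarith

theorem batchLength_pos {d : ℝ} {T : ℕ} (hT : 2 ≤ T) : 0 < batchLength d T := by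
  have : (0 : ℝ) < T := by positivity
  exact Nat.ceil_pos.2 (by positivity)

theorem le_batchLength (d : ℝ) (T : ℕ) : (T : ℝ) ^ ((d + 2) / (d + 4)) ≤ batchLength d T :=
  Nat.le_ceil _

theorem batchLength_le {d : ℝ} (hd : 0 ≤ d) {T : ℕ} (hT : 2 ≤ T) :
    (batchLength d T : ℝ) ≤ 2 * (T : ℝ) ^ ((d + 2) / (d + 4)) := by
  have hT' : (1 : ℝ) ≤ T := by exact_mod_cast (by omega : 1 ≤ T)
  have h1 : 1 ≤ (T : ℝ) ^ ((d + 2) / (d + 4)) := Real.one_le_rpow hT' (by positivity)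
  have h2 := Nat.ceil_lt_add_one (a := (T : ℝ) ^ ((d + 2) / (d + 4))) (by positivity)
  unfold batchLength
  linarith

theorem batchLength_le_self {d : ℝ} (hd : 0 ≤ d) {T : ℕ} (hT : 2 ≤ T) : batchLength d T ≤ T := by
  have hT' : (1 : ℝ) ≤ T := by exact_mod_cast (by omega : 1 ≤ T)
  refine Nat.ceil_le.2 ?_
  calc (T : ℝ) ^ ((d + 2) / (d + 4)) ≤ (T : ℝ) ^ (1 : ℝ) :=
        Real.rpow_le_rpow_of_exponent_le hT' ((div_le_one (by positivity)).2 (by linarith))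
    _ = T := Real.rpow_one _

theorem numBatch_le_div {T H : ℕ} (hH : 0 < H) (hHT : H ≤ T) :
    (numBatch T H : ℝ) ≤ 2 * (T / H) := by
  have hH' : (0 : ℝ) < H := by exact_mod_cast hH
  have h1 : (1 : ℝ) ≤ T / H := (one_le_div hH').2 (by exact_mod_cast hHT)
  have h2 := Nat.ceil_lt_add_one (a := (T : ℝ) / H) (by positivity)
  unfold numBatch
  linarith

theorem numBatch_le_self {T H : ℕ} (hH : 0 < H) : numBatch T H ≤ T := by
  refine Nat.ceil_le.2 (div_le_self (by positivity) ?_)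
  exact_mod_cast hH

theorem numBatch_pos {T H : ℕ} (hH : 0 < H) (hHT : H ≤ T) : 0 < numBatch T H := by
  have hH' : (0 : ℝ) < H := by exact_mod_cast hH
  have hT' : (0 : ℝ) < T := by exact_mod_cast (by omega : 0 < T)
  exact Nat.ceil_pos.2 (by positivity)

theorem le_numBatch_mul {T H : ℕ} (hH : 0 < H) : (T : ℝ) ≤ numBatch T H * H := by
  have hH' : (0 : ℝ) < H := by exact_mod_cast hH
  exact (div_le_iff₀ hH').1 (Nat.le_ceil _)

theorem div_le_numBatch (T H : ℕ) : ((T / H : ℕ) : ℝ) ≤ numBatch T H :=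
  Nat.cast_div_le.trans (Nat.le_ceil _)

theorem gamma_mul_le {N M : ℕ} {l : ℝ} (hM : 0 < M) (hl : 0 ≤ l)
    (hN : N * Real.log N ≤ 2 * l ^ 2) : gamma N M * M ≤ 3 * l * √M := by
  have hM' : (0 : ℝ) < M := by exact_mod_cast hM
  have hNl : 0 ≤ Real.log N := Real.log_natCast_nonneg N
  have h1 : √(3 * N * Real.log N / (5 * M)) * M ≤ 3 / 2 * l * √M := by
    calc √(3 * N * Real.log N / (5 * M)) * M = √(3 * N * Real.log N / (5 * M)) * √(M ^ 2) := by
          rw [Real.sqrt_sq hM'.le]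
      _ = √(3 * N * Real.log N / (5 * M) * M ^ 2) := (Real.sqrt_mul (by positivity) _).symm
      _ = √(3 / 5 * (N * Real.log N) * M) := by congr 1; field_simp
      _ ≤ √((3 / 2 * l) ^ 2 * M) := by
          refine Real.sqrt_le_sqrt (mul_le_mul_of_nonneg_right ?_ hM'.le)
          nlinarith [sq_nonneg l]
      _ = 3 / 2 * l * √M := by
          rw [Real.sqrt_mul (by positivity), Real.sqrt_sq (by positivity)]
  calc gamma N M * M ≤ 2 * √(3 * N * Real.log N / (5 * M)) * M :=
        mul_le_mul_of_nonneg_right (min_le_right _ _) hM'.le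
    _ ≤ _ := by linarith

/-- If `γ = 3 / 5`, the quotient is of order `N * log N`. Otherwise `γ = 2 * √q` with `3 * N * log N
= 5 * M * q`, so the quotient is `(5 / 2) * M * √q`, of order `√(M * N * log N)`. -/
theorem div_gamma_le {N M : ℕ} {l : ℝ} (hN2 : 2 ≤ N) (hM : 0 < M) (hl : 1 ≤ l)
    (hN : N * Real.log N ≤ 2 * l ^ 2) :
    3 * N * Real.log N / gamma N M ≤ 14 * l ^ 2 * √M := by
  have hM' : (1 : ℝ) ≤ M := by exact_mod_cast hM
  have hN1 : (1 : ℝ) < N := by exact_mod_cast hN2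
  have hNl : 0 < Real.log N := Real.log_pos hN1
  have hsM : 1 ≤ √M := Real.one_le_sqrt.2 hM'
  have hγ := gamma_pos hN2 hM
  rw [div_le_iff₀ hγ]
  unfold gamma
  rcases min_choice (3 / 5 : ℝ) (2 * √(3 * N * Real.log N / (5 * M))) with h | h <;> rw [h]
  · have : 2 * l ^ 2 * 1 ≤ 2 * l ^ 2 * √M := by gcongr
    nlinarith [sq_nonneg l]
  · set q := 3 * N * Real.log N / (5 * M) with hq
    have hq0 : 0 < q := by positivity
    have e : 3 * N * Real.log N = 5 * M * (√q * √q) := by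
      rw [Real.mul_self_sqrt hq0.le, hq]; field_simp
    have h1 : √M * √q ≤ 2 * l ^ 2 := by
      rw [← Real.sqrt_mul (by positivity)]
      refine Real.sqrt_le_iff.2 ⟨by positivity, ?_⟩
      have e2 : (M : ℝ) * q = 3 / 5 * (N * Real.log N) := by rw [hq]; field_simp
      have : l ^ 2 * 1 ≤ l ^ 2 * l ^ 2 := by
        gcongr; exact one_le_pow₀ hl
      rw [e2]; nlinarith
    have e3 : (M : ℝ) = √M * √M := (Real.mul_self_sqrt (by positivity)).symm
    rw [e]
    calc 5 * (M : ℝ) * (√q * √q) = 5 * (√M * √M) * (√q * √q) := by rw [← e3]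
      _ = 5 * (√M * √q) * (√M * √q) := by ring
      _ ≤ 5 * (2 * l ^ 2) * (√M * √q) := by gcongr
      _ ≤ 14 * l ^ 2 * √M * (2 * √q) := by
          have : 0 ≤ l ^ 2 * (√M * √q) := by positivity
          linarith

/-- The regret of EXP3.P is of order `√M`. -/
theorem exp3_error_le {N M m : ℕ} {l α β a₁ a₂ : ℝ} (hN2 : 2 ≤ N) (hM : 0 < M) (hmM : m ≤ M)
    (hl : 1 ≤ l) (hN : (N : ℝ) ≤ 2 * l) (hNlog : Real.log N ≤ l)
    (hα : 0 < α) (hα2 : α ^ 2 ≤ 12 * l) (hβ : β = α / √((N : ℝ) * M)) (ha₁ : a₁ ≤ α ^ 2)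
    (ha₂ : a₂ ≤ 6 * l) :
    gamma N M * m + a₁ / β + 3 * N * Real.log N / gamma N M + m * (N * β) +
        5 / 3 * (2 * gamma N M * m + N * a₂) + m * (2 / 3 * N * β ^ 2) ≤ 65 * l ^ 2 * √M := by
  have hM' : (1 : ℝ) ≤ M := by exact_mod_cast hM
  have hm' : (m : ℝ) ≤ M := by exact_mod_cast hmM
  have hN0 : (0 : ℝ) < N := by exact_mod_cast (by omega : 0 < N)
  have hsM : 1 ≤ √M := Real.one_le_sqrt.2 hM'
  have hNl0 : 0 ≤ Real.log N := Real.log_natCast_nonneg N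
  have hγ := gamma_pos hN2 hM
  have hNN : N * Real.log N ≤ 2 * l ^ 2 := by nlinarith
  have h1 := gamma_mul_le hM (by linarith : 0 ≤ l) hNN
  have h2 := div_gamma_le hN2 hM hl hNN
  set q := √((N : ℝ) * M) with hq
  have hq0 : 0 < q := Real.sqrt_pos.2 (by positivity)
  have hqq : q * q = N * M := Real.mul_self_sqrt (by positivity)
  have hαq : α * q ≤ 5 * l * √M := by
    have e1 : α * q = √(α ^ 2 * (N * M)) := by
      rw [Real.sqrt_mul (sq_nonneg α), Real.sqrt_sq hα.le]
    rw [e1]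
    refine Real.sqrt_le_iff.2 ⟨by positivity, ?_⟩
    rw [mul_pow, Real.sq_sqrt (by positivity)]
    calc α ^ 2 * (N * M) ≤ 12 * l * (2 * l * M) := by gcongr
      _ ≤ _ := by nlinarith [sq_nonneg l]
  have hβ0 : 0 < β := by rw [hβ]; positivity
  have hlM : l ≤ l ^ 2 * √M := by
    calc l = l ^ 1 * 1 := by ring
      _ ≤ _ := by gcongr; norm_num
  have hlM2 : l * √M ≤ l ^ 2 * √M := by
    calc l * √M = l ^ 1 * √M := by ring
      _ ≤ _ := by gcongr; norm_num
  have hl2M : l ^ 2 ≤ l ^ 2 * √M := le_mul_of_one_le_right (by positivity) hsM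
  have t1 : gamma N M * m ≤ gamma N M * M := by gcongr
  have t2 : a₁ / β ≤ α * q := by
    rw [div_le_iff₀ hβ0, hβ]
    calc a₁ ≤ α ^ 2 := ha₁
      _ = _ := by field_simp
  have t3 : m * (N * β) ≤ α * q := by
    calc m * (N * β) ≤ M * (N * β) := by gcongr
      _ = N * M * β := by ring
      _ = q * q * (α / q) := by rw [hqq, hβ]
      _ = α * q := by field_simp
  have t4 : N * a₂ ≤ 12 * l ^ 2 := by
    calc N * a₂ ≤ N * (6 * l) := by gcongr
      _ ≤ 2 * l * (6 * l) := by gcongr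
      _ = _ := by ring
  have t5 : m * (2 / 3 * N * β ^ 2) ≤ 8 * l := by
    calc m * (2 / 3 * N * β ^ 2) ≤ M * (2 / 3 * N * β ^ 2) := by gcongr
      _ = 2 / 3 * (N * M) * (α / q) ^ 2 := by rw [hβ]; ring
      _ = 2 / 3 * α ^ 2 := by rw [← hqq]; field_simp
      _ ≤ _ := by linarith
  -- In the order of the summands, `65 = 3 + 5 + 14 + 5 + 30 + 8`.
  linarith

end Magnitudes

/-! ### Exponents of the horizon produced by the batch length -/

section Powers

variable {d : ℝ} {T : ℕ}

theorem mul_batchLength_rpow_le (hT : 2 ≤ T) {a e : ℝ} (ha : 0 ≤ a)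
    (h : 1 - (d + 2) / (d + 4) * a ≤ e) : T * (batchLength d T : ℝ) ^ (-a) ≤ (T : ℝ) ^ e := by
  have hT' : (1 : ℝ) ≤ T := by exact_mod_cast (by omega : 1 ≤ T)
  have hT0 : (0 : ℝ) < T := by linarith
  calc T * (batchLength d T : ℝ) ^ (-a)
      ≤ T * ((T : ℝ) ^ ((d + 2) / (d + 4))) ^ (-a) := by
        refine mul_le_mul_of_nonneg_left ?_ hT0.le
        exact Real.rpow_le_rpow_of_nonpos (by positivity) (le_batchLength d T) (by linarith)
    _ = (T : ℝ) ^ (1 - (d + 2) / (d + 4) * a) := by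
        rw [← Real.rpow_mul hT0.le, sub_eq_add_neg, Real.rpow_add hT0, Real.rpow_one, mul_neg]
    _ ≤ _ := Real.rpow_le_rpow_of_exponent_le hT' h

/-- The exponents agree exactly: this is one half of the balance that fixes the batch length. -/
theorem mul_batchLength_rpow_two_le (hd : 0 ≤ d) (hT : 2 ≤ T) :
    T * (batchLength d T : ℝ) ^ (-(1 / (d + 2))) ≤ (T : ℝ) ^ ((d + 3) / (d + 4)) := by
  refine mul_batchLength_rpow_le hT (by positivity) (le_of_eq ?_)
  field_simp; ring

theorem mul_batchLength_rpow_one_le (hd : 0 ≤ d) (hT : 2 ≤ T) :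
    T * (batchLength d T : ℝ) ^ (-(1 / (d + 1))) ≤ (T : ℝ) ^ ((d + 2) / (d + 3)) := by
  refine mul_batchLength_rpow_le hT (by positivity) ?_
  have e : (d + 2) / (d + 3) - (1 - (d + 2) / (d + 4) * (1 / (d + 1))) =
      2 / ((d + 1) * (d + 3) * (d + 4)) := by field_simp; ring
  have : 0 ≤ 2 / ((d + 1) * (d + 3) * (d + 4)) := by positivity
  linarith

theorem batchLength_le_rpow (hd : 0 ≤ d) (hT : 2 ≤ T) :
    (batchLength d T : ℝ) ≤ 2 * (T : ℝ) ^ ((d + 3) / (d + 4)) := by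
  have hT' : (1 : ℝ) ≤ T := by exact_mod_cast (by omega : 1 ≤ T)
  refine (batchLength_le hd hT).trans (mul_le_mul_of_nonneg_left ?_ (by norm_num))
  exact Real.rpow_le_rpow_of_exponent_le hT' (by gcongr; norm_num)

theorem div_mul_sqrt_batchLength_le (hd : 0 ≤ d) (hT : 2 ≤ T) :
    T / batchLength d T * √(batchLength d T) ≤ (T : ℝ) ^ ((d + 3) / (d + 4)) := by
  have hH : (1 : ℝ) ≤ batchLength d T := by exact_mod_cast batchLength_pos hT
  have hH0 : (0 : ℝ) < batchLength d T := by linarith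
  have e : T / batchLength d T * √(batchLength d T) = T * (batchLength d T : ℝ) ^ (-(1 / 2) : ℝ) := by
    rw [div_mul_eq_mul_div, mul_div_assoc, Real.sqrt_div_self', Real.sqrt_eq_rpow,
      Real.rpow_neg hH0.le, one_div]
  rw [e]
  refine mul_batchLength_rpow_le hT (by norm_num) ?_
  have e2 : (d + 3) / (d + 4) - (1 - (d + 2) / (d + 4) * (1 / 2)) = d / (2 * (d + 4)) := by
    field_simp; ring
  have : 0 ≤ d / (2 * (d + 4)) := by positivity
  linarith

/-- The other half of the balance: `H * √M` is of order `√(T * H)`, and `(1 + (d + 2) / (d + 4)) / 2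
= (d + 3) / (d + 4)`. -/
theorem batchLength_mul_sqrt_numBatch_le (hd : 0 ≤ d) (hT : 2 ≤ T) :
    batchLength d T * √(numBatch T (batchLength d T)) ≤ 2 * (T : ℝ) ^ ((d + 3) / (d + 4)) := by
  have hT0 : (0 : ℝ) < T := by positivity
  have hH0 : (0 : ℝ) < batchLength d T := by exact_mod_cast batchLength_pos hT
  calc batchLength d T * √(numBatch T (batchLength d T))
      = √((batchLength d T : ℝ) ^ 2 * numBatch T (batchLength d T)) := by
        rw [Real.sqrt_mul (sq_nonneg _), Real.sqrt_sq hH0.le]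
    _ ≤ √((2 * (T : ℝ) ^ ((d + 3) / (d + 4))) ^ 2) := by
        refine Real.sqrt_le_sqrt ?_
        calc (batchLength d T : ℝ) ^ 2 * numBatch T (batchLength d T)
            ≤ (batchLength d T : ℝ) ^ 2 * (2 * (T / batchLength d T)) := by
              gcongr
              exact numBatch_le_div (batchLength_pos hT) (batchLength_le_self hd hT)
          _ = 2 * (T : ℝ) * batchLength d T := by field_simp
          _ ≤ 2 * (T : ℝ) * (2 * (T : ℝ) ^ ((d + 2) / (d + 4))) := by
              gcongr
              exact batchLength_le hd hT
          _ = 4 * (T : ℝ) ^ (1 + (d + 2) / (d + 4)) := by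
              rw [Real.rpow_add hT0, Real.rpow_one]; ring
          _ = (2 * (T : ℝ) ^ ((d + 3) / (d + 4))) ^ 2 := by
              rw [mul_pow, ← Real.rpow_natCast ((T : ℝ) ^ _), ← Real.rpow_mul hT0.le]
              norm_num
              congr 1
              field_simp; ring
    _ = _ := Real.sqrt_sq (by positivity)

/-- The exponents of the two terms of the regret in a batch, multiplied by the number of batches. -/
theorem mul_max_le (hd : 0 ≤ d) (hT : 2 ≤ T) {w C : ℝ} (hw0 : 0 ≤ w) (hC : 0 ≤ C)
    (hw : w ≤ 2 + 2 * C) :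
    T * max ((batchLength d T : ℝ) ^ (-(1 / (d + 2)))) ((w / batchLength d T) ^ (1 / (d + 1))) ≤
      3 * ((T : ℝ) ^ ((d + 3) / (d + 4)) + C ^ (1 / (d + 1)) * (T : ℝ) ^ ((d + 2) / (d + 3))) := by
  have hT0 : (0 : ℝ) < T := by positivity
  have hH1 : (1 : ℝ) ≤ batchLength d T := by exact_mod_cast batchLength_pos hT
  have h1 := mul_batchLength_rpow_two_le hd hT
  have h2 := mul_batchLength_rpow_one_le hd hT
  set H := (batchLength d T : ℝ)
  have hH0 : 0 < H := by linarith
  set X := (T : ℝ) ^ ((d + 3) / (d + 4))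
  set Y := (T : ℝ) ^ ((d + 2) / (d + 3))
  set e := 1 / (d + 1) with he
  have he0 : 0 ≤ e := by positivity
  have he1 : e ≤ 1 := (div_le_one (by positivity)).2 (by linarith)
  have h2e : (2 : ℝ) ^ e ≤ 2 := by
    calc (2 : ℝ) ^ e ≤ (2 : ℝ) ^ (1 : ℝ) := Real.rpow_le_rpow_of_exponent_le (by norm_num) he1
      _ = 2 := Real.rpow_one _
  have h3 : H ^ (-e) ≤ H ^ (-(1 / (d + 2))) := by
    refine Real.rpow_le_rpow_of_exponent_le hH1 (neg_le_neg ?_)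
    exact one_div_le_one_div_of_le (by positivity) (by linarith)
  have h4 : (w / H) ^ e ≤ 2 * H ^ (-e) + 2 * (C ^ e * H ^ (-e)) := by
    calc (w / H) ^ e ≤ ((2 + 2 * C) / H) ^ e := by gcongr
      _ = (2 + 2 * C) ^ e * H ^ (-e) := by
          rw [Real.div_rpow (by positivity) hH0.le, Real.rpow_neg hH0.le, div_eq_mul_inv]
      _ ≤ (2 ^ e + (2 * C) ^ e) * H ^ (-e) := by
          -- Powers with exponent in `[0, 1]` are subadditive, which separates the constant 2 from
          -- the corruption.
          gcongr
          exact Real.rpow_add_le_add_rpow (by norm_num) (by positivity) he0 he1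
      _ = 2 ^ e * (H ^ (-e) + C ^ e * H ^ (-e)) := by
          rw [Real.mul_rpow (by norm_num) hC]; ring
      _ ≤ 2 * (H ^ (-e) + C ^ e * H ^ (-e)) := by gcongr
      _ = _ := by ring
  have hCe : 0 ≤ C ^ e := Real.rpow_nonneg hC e
  have hHe : 0 ≤ H ^ (-e) := Real.rpow_nonneg hH0.le _
  have hCH : 0 ≤ C ^ e * H ^ (-e) := mul_nonneg hCe hHe
  have hHd : 0 ≤ H ^ (-(1 / (d + 2))) := Real.rpow_nonneg hH0.le _
  have h5 : max (H ^ (-(1 / (d + 2)))) ((w / H) ^ e) ≤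
      2 * H ^ (-(1 / (d + 2))) + 2 * (C ^ e * H ^ (-e)) := by
    refine max_le ?_ ?_ <;> linarith
  have h6 : C ^ e * (T * H ^ (-e)) ≤ C ^ e * Y := mul_le_mul_of_nonneg_left h2 hCe
  have hX0 : 0 ≤ X := by positivity
  have hY0 : 0 ≤ C ^ e * Y := by positivity
  calc T * max (H ^ (-(1 / (d + 2)))) ((w / H) ^ e)
      ≤ T * (2 * H ^ (-(1 / (d + 2))) + 2 * (C ^ e * H ^ (-e))) := by gcongr
    _ = 2 * (T * H ^ (-(1 / (d + 2)))) + 2 * (C ^ e * (T * H ^ (-e))) := by ring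
    _ ≤ _ := by linarith

/-- The cube of `l` comes from the master: `l ^ 2` from the EXP3.P error and one more factor from
the noise in the normalisation `2 * H + ν ≤ 7 * l * H`. -/
theorem total_le {κ : ℝ} (hd : 0 ≤ d) (hκ : 0 < κ) (hT : 2 ≤ T) {l L w C ν K E : ℝ} (hl : 1 ≤ l)
    (hL : L ≤ 12 * l) (hw0 : 0 ≤ w) (hC : 0 ≤ C) (hw : w ≤ 2 + 2 * C) (hν0 : 0 ≤ ν)
    (hν : ν ≤ 5 * l * √(batchLength d T))
    (hK : K = batchLength d T * (C / batchLength d T) ^ (1 / (d + 1)))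
    (hE : E ≤ 65 * l ^ 2 * √(numBatch T (batchLength d T))) :
    batchLength d T + (T / batchLength d T : ℕ) *
        (6 * (1 + √(L * (κ * 2 ^ d)) + κ * 2 ^ d) * (batchLength d T *
          max ((batchLength d T : ℝ) ^ (-(1 / (d + 2)))) ((w / batchLength d T) ^ (1 / (d + 1)))) +
          2 * ν + 2 * K) + (2 * batchLength d T + ν) * E ≤
      (18 * (1 + 4 * √(κ * 2 ^ d) + κ * 2 ^ d) + 1000) * l ^ 3 *
        ((T : ℝ) ^ ((d + 3) / (d + 4)) + C ^ (1 / (d + 1)) * (T : ℝ) ^ ((d + 2) / (d + 3))) := by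
  have hT0 : (0 : ℝ) < T := by positivity
  have hH1 : (1 : ℝ) ≤ batchLength d T := by exact_mod_cast batchLength_pos hT
  have h1 := mul_max_le hd hT hw0 hC hw
  have h2 := mul_batchLength_rpow_one_le hd hT
  have h3 := batchLength_le_rpow hd hT
  have h4 := div_mul_sqrt_batchLength_le hd hT
  have h5 := batchLength_mul_sqrt_numBatch_le hd hT
  have hm : ((T / batchLength d T : ℕ) : ℝ) ≤ T / batchLength d T := Nat.cast_div_le
  set m := ((T / batchLength d T : ℕ) : ℝ)
  set H := (batchLength d T : ℝ)
  set M := (numBatch T (batchLength d T) : ℝ)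
  have hH0 : 0 < H := by linarith
  set X := (T : ℝ) ^ ((d + 3) / (d + 4))
  set Y := (T : ℝ) ^ ((d + 2) / (d + 3))
  set e := 1 / (d + 1) with he
  set k := κ * (2 : ℝ) ^ d with hk
  have hk0 : 0 < k := by positivity
  have hCe : 0 ≤ C ^ e := Real.rpow_nonneg hC e
  have hX0 : 0 ≤ X := by positivity
  have hY0 : 0 ≤ C ^ e * Y := by positivity
  have hm0 : 0 ≤ m := Nat.cast_nonneg _
  have hmH : m * H ≤ T := (le_div_iff₀ hH0).1 hm
  set Z := X + C ^ e * Y with hZ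
  have hZ0 : 0 ≤ Z := by positivity
  have hXZ : X ≤ Z := by linarith
  set D := max (H ^ (-(1 / (d + 2)))) ((w / H) ^ e) with hD
  have hD0 : 0 ≤ D := le_max_of_le_left (Real.rpow_nonneg hH0.le _)
  have hl3 : l ≤ l ^ 3 := le_self_pow₀ hl (by norm_num)
  have hl31 : 1 ≤ l ^ 3 := one_le_pow₀ hl
  have hcoef : 6 * (1 + √(L * k) + k) ≤ 6 * (1 + 4 * √k + k) * l := by
    have : √(L * k) ≤ 4 * √k * l := by
      refine Real.sqrt_le_iff.2 ⟨by positivity, ?_⟩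
      rw [mul_pow, mul_pow, Real.sq_sqrt hk0.le]
      calc L * k ≤ 12 * l * k := by gcongr
        _ ≤ 12 * l ^ 2 * k := by gcongr; exact le_self_pow₀ hl (by norm_num)
        _ ≤ _ := by linarith only [mul_nonneg (sq_nonneg l) hk0.le]
    have h6 : (1 + k) * 1 ≤ (1 + k) * l := by gcongr
    linarith only [this, h6]
  have t1 : m * (6 * (1 + √(L * k) + k) * (H * D)) ≤ 18 * (1 + 4 * √k + k) * (l ^ 3 * Z) := by
    calc m * (6 * (1 + √(L * k) + k) * (H * D)) = 6 * (1 + √(L * k) + k) * (m * H * D) := by ring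
      _ ≤ 6 * (1 + 4 * √k + k) * l * (T * D) := by gcongr
      _ ≤ 6 * (1 + 4 * √k + k) * l ^ 3 * (3 * Z) := by gcongr
      _ = _ := by ring
  have t2 : m * ν ≤ 5 * (l ^ 3 * Z) := by
    calc m * ν ≤ T / H * (5 * l * √H) := by gcongr
      _ = 5 * l * (T / H * √H) := by ring
      _ ≤ 5 * l ^ 3 * Z := by
          have := h4.trans hXZ
          gcongr
      _ = _ := by ring
  have t3 : m * K ≤ l ^ 3 * Z := by
    have e1 : (C / H) ^ e = C ^ e * H ^ (-e) := by
      rw [Real.div_rpow hC hH0.le, Real.rpow_neg hH0.le, div_eq_mul_inv]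
    have h0 : 0 ≤ (C / H) ^ e := by positivity
    calc m * K = m * H * (C / H) ^ e := by rw [hK]; ring
      _ ≤ T * (C / H) ^ e := by gcongr
      _ = C ^ e * (T * H ^ (-e)) := by rw [e1]; ring
      _ ≤ C ^ e * Y := by gcongr
      _ ≤ 1 * Z := by linarith
      _ ≤ _ := by gcongr
  have t4 : (2 * H + ν) * E ≤ 910 * (l ^ 3 * Z) := by
    have hs : √H ≤ H := Real.sqrt_le_iff.2 ⟨hH0.le, le_self_pow₀ hH1 (by norm_num)⟩
    have hQ : 2 * H + ν ≤ 7 * l * H := by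
      have h6 : 5 * l * √H ≤ 5 * l * H := by gcongr
      have h7 : 1 * H ≤ l * H := by gcongr
      linarith only [h6, h7, hν]
    calc (2 * H + ν) * E ≤ (2 * H + ν) * (65 * l ^ 2 * √M) := by gcongr
      _ ≤ 7 * l * H * (65 * l ^ 2 * √M) := by gcongr
      _ = 455 * l ^ 3 * (H * √M) := by ring
      _ ≤ 455 * l ^ 3 * (2 * X) := by gcongr
      _ ≤ 455 * l ^ 3 * (2 * Z) := by gcongr
      _ = _ := by ring
  have t5 : H ≤ 2 * (l ^ 3 * Z) := by
    have : 1 * Z ≤ l ^ 3 * Z := by gcongr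
    linarith
  have : 0 ≤ l ^ 3 * Z := by positivity
  -- The numerical terms sum to `2 * 5 + 2 * 1 + 910 + 2 = 924`, below 1000.
  linarith only [t1, t2, t3, t4, t5, this]

end Powers

/-! ### Union bound over the bad events and the final estimate -/

section Main

theorem measure_biUnion_finset_le_ofReal {Ω ι : Type*} {mΩ : MeasurableSpace Ω} (P : Measure Ω)
    (s : Finset ι) (A : ι → Set Ω) {ε : ℝ} (h : ∀ k ∈ s, P (A k) ≤ ENNReal.ofReal ε) :
    P (⋃ k ∈ s, A k) ≤ ENNReal.ofReal (s.card * ε) := by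
  refine (measure_biUnion_finset_le s A).trans ((Finset.sum_le_sum h).trans_eq ?_)
  rw [Finset.sum_const, nsmul_eq_mul, ENNReal.ofReal_mul (Nat.cast_nonneg _),
    ENNReal.ofReal_natCast]

/-- The levels are consecutive powers of 2, the largest at least `T`. They start at 2, so the index
is one less than the rounded-up logarithm, and `C ≤ 1` is served by index 0. -/
theorem exists_level {T : ℕ} (hT : 2 ≤ T) {C : ℝ} (hC0 : 0 ≤ C) (hC : C ≤ T) :
    ∃ j : Fin (numBase T), C ≤ level j ∧ level j ≤ 2 + 2 * C := by
  have hN : 0 < numBase T := Nat.clog_pos (by norm_num) hT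
  have hk : Nat.clog 2 ⌈C⌉₊ ≤ numBase T := Nat.clog_mono_right 2 (Nat.ceil_le.2 hC)
  have h1 : C ≤ 2 ^ Nat.clog 2 ⌈C⌉₊ :=
    (Nat.le_ceil C).trans (by exact_mod_cast Nat.le_pow_clog (by norm_num) ⌈C⌉₊)
  rcases Nat.eq_zero_or_pos (Nat.clog 2 ⌈C⌉₊) with h0 | hpos
  · refine ⟨⟨0, hN⟩, ?_, ?_⟩
    · rw [h0] at h1
      simp only [level]
      norm_num at h1 ⊢
      linarith
    · simp only [level]
      norm_num
      linarith
  · refine ⟨⟨Nat.clog 2 ⌈C⌉₊ - 1, by omega⟩, ?_, ?_⟩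
    · simp only [level]
      rwa [Nat.sub_add_cancel hpos]
    · have hceil : 1 < ⌈C⌉₊ := by
        by_contra hle
        rw [Nat.clog_of_right_le_one (by omega)] at hpos
        exact lt_irrefl _ hpos
      have h2 : ((2 : ℕ) ^ (Nat.clog 2 ⌈C⌉₊ - 1) : ℕ) < ⌈C⌉₊ :=
        Nat.pow_pred_clog_lt_self (by norm_num) hceil
      have h3 : (2 : ℝ) ^ (Nat.clog 2 ⌈C⌉₊ - 1) < ⌈C⌉₊ := by exact_mod_cast h2
      have h4 := Nat.ceil_lt_add_one hC0
      simp only [level]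
      rw [pow_succ]
      linarith

variable {X Ω : Type*}

theorem regret_le {μ : X → ℝ} (hμ01 : ∀ x, μ x ∈ Set.Icc (0 : ℝ) 1) (xopt : X) (T : ℕ)
    (x : ℕ → Ω → X) (ω : Ω) : regret μ xopt T x ω ≤ T := by
  have h1 : 0 ≤ ∑ t ∈ Finset.range T, μ (x t ω) := Finset.sum_nonneg fun t _ => (hμ01 _).1
  have h2 := mul_le_mul_of_nonneg_left (hμ01 xopt).2 (Nat.cast_nonneg (α := ℝ) T)
  unfold regret
  linarith

variable [MetricSpace X] [CompactSpace X] [MeasurableSpace X] [BorelSpace X]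
  {mΩ : MeasurableSpace Ω} {P : Measure Ω} [IsProbabilityMeasure P]
  {ℱ : Filtration ℕ mΩ} {T H : ℕ} {δ : ℝ} {η c : ℕ → Ω → ℝ}
  {i : ℕ → Ω → Fin (numBase T)} {x : ℕ → Ω → X} {μ : X → ℝ} {xopt : X} {d κ : ℝ}

theorem alpha_sq_le (hT : 3 ≤ T) (hH : 0 < H) (hHT : H ≤ T) (hδ0 : 0 < δ) (hδ1 : δ < 1) :
    0 < alpha (numBase T) (numBatch T H) δ ∧
    alpha (numBase T) (numBatch T H) δ ^ 2 ≤ 12 * (2 * Real.log (T / δ)) ∧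
    Real.log (3 * numBase T / δ) ≤ alpha (numBase T) (numBatch T H) δ ^ 2 := by
  have hN : (2 : ℝ) ≤ numBase T := by exact_mod_cast two_le_numBase hT
  have hM : (1 : ℝ) ≤ numBatch T H := by exact_mod_cast numBatch_pos hH hHT
  have hNT : (numBase T : ℝ) ≤ T := by exact_mod_cast numBase_le_self T
  have hMT : (numBatch T H : ℝ) ≤ T := by exact_mod_cast numBatch_le_self (T := T) hH
  have h1 : Real.log (3 * numBase T * numBatch T H / δ) ≤ 3 * (2 * Real.log (T / δ)) := by
    rw [mul_assoc]
    refine log_mul_div_le (by omega) hδ0 hδ1 (by norm_num) (by positivity) ?_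
    rw [sq]
    gcongr
  have h2 : Real.log (3 * numBase T / δ) ≤ Real.log (3 * numBase T * numBatch T H / δ) := by
    refine Real.log_le_log (by positivity) ?_
    exact div_le_div_of_nonneg_right (le_mul_of_one_le_right (by positivity) hM) hδ0.le
  have h3 : 0 < Real.log (3 * numBase T / δ) := by
    refine Real.log_pos ((one_lt_div hδ0).2 ?_)
    linarith
  have h4 : alpha (numBase T) (numBatch T H) δ ^ 2 =
      4 * Real.log (3 * numBase T * numBatch T H / δ) := by
    unfold alpha
    rw [mul_pow, Real.sq_sqrt (by linarith)]
    norm_num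
  refine ⟨?_, by linarith, by linarith⟩
  unfold alpha
  have : 0 < Real.log (3 * numBase T * numBatch T H / δ) := by linarith
  positivity

/-- The regret bound with explicit constants, in the nontrivial range of parameters. -/
theorem measure_regret_ge_of_three_le (hd : 0 ≤ d) (hκ : 0 < κ) (hX : HasCoveringBound X d κ)
    (hμ : LipschitzWith 1 μ) (hμ01 : ∀ x, μ x ∈ Set.Icc (0 : ℝ) 1) (hopt : ∀ x, μ x ≤ μ xopt)
    (hT : 3 ≤ T) (hδ0 : 0 < δ) (hδ1 : δ < 1) (hE : IsEnvironment P ℱ T η c)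
    (hR : IsRun P ℱ T (batchLength d T) δ i x (reward μ x η c))
    (hβ2 : alpha (numBase T) (numBatch T (batchLength d T)) δ /
      √((numBase T : ℝ) * numBatch T (batchLength d T)) ≤ 2) :
    ENNReal.ofReal (1 - δ) ≤ P {ω | regret μ xopt T x ω ≤
      (18 * (1 + 4 * √(κ * 2 ^ d) + κ * 2 ^ d) + 1000) * (2 * Real.log (T / δ)) ^ 3 *
        ((T : ℝ) ^ ((d + 3) / (d + 4)) +
          totalCorruption T c ω ^ (1 / (d + 1)) * (T : ℝ) ^ ((d + 2) / (d + 3)))} := by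
  classical
  have hT2 : 2 ≤ T := by omega
  have hT0 : (0 : ℝ) < T := by positivity
  have hH : 0 < batchLength d T := batchLength_pos hT2
  have hHT : batchLength d T ≤ T := batchLength_le_self hd hT2
  obtain ⟨hα0, hα2, ha₁α⟩ := alpha_sq_le (δ := δ) hT hH hHT hδ0 hδ1
  set H := batchLength d T with hHdef
  set M := numBatch T H with hMdef
  set l := 2 * Real.log (T / δ) with hl
  have hl1 : 1 ≤ l := one_le_two_mul_log hT2 hδ0 hδ1
  have hN : 2 ≤ numBase T := two_le_numBase hT
  have hM : 0 < M := numBatch_pos hH hHT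
  have hN0 : (2 : ℝ) ≤ numBase T := by exact_mod_cast hN
  have hM0 : (1 : ℝ) ≤ M := by exact_mod_cast hM
  have hH0 : (0 : ℝ) < H := by exact_mod_cast hH
  have hHT' : (H : ℝ) ≤ T := by exact_mod_cast hHT
  have hNT : (numBase T : ℝ) ≤ T := by exact_mod_cast numBase_le_self T
  have hT1 : (1 : ℝ) ≤ T := by exact_mod_cast (by omega : 1 ≤ T)
  set β := alpha (numBase T) M δ / √((numBase T : ℝ) * M) with hβ
  have hβ0 : 0 < β := by positivity
  -- The four thresholds allot failure probabilities `δ / 3`, `δ / 6`, `δ / 6` and `δ / 3`: to the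
  -- counts of the levels from below, to those counts from above, to the noise of the batches, and
  -- to the noise of the arms over at most `T ^ 2` pairs.
  set a₁ := Real.log (3 * numBase T / δ) with ha₁
  set a₂ := Real.log (6 * numBase T / δ) with ha₂
  set a₃ := Real.log (12 * T / (H * δ)) with ha₃
  set a₄ := 2 * Real.log T + Real.log (2 / (δ / 3)) with ha₄
  have ha₁0 : 0 ≤ a₁ := Real.log_nonneg ((one_le_div hδ0).2 (by linarith))
  have ha₂0 : 0 ≤ a₂ := Real.log_nonneg ((one_le_div hδ0).2 (by linarith))
  have ha₃0 : 0 ≤ a₃ := by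
    refine Real.log_nonneg ((one_le_div (by positivity)).2 ?_)
    have : H * δ ≤ T * 1 := by gcongr
    linarith
  have ha₄e : a₄ = Real.log (6 * T ^ 2 / δ) := by
    rw [ha₄, ← Nat.cast_ofNat (R := ℝ) (n := 2), ← Real.log_pow,
      ← Real.log_mul (by positivity) (by positivity)]
    congr 1
    push_cast
    field_simp
    ring
  have ha₄0 : 0 ≤ a₄ := by
    rw [ha₄e]
    refine Real.log_nonneg ((one_le_div hδ0).2 ?_)
    have := one_le_pow₀ (n := 2) hT1
    linarith
  have ha₂l : a₂ ≤ 6 * l := by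
    refine log_mul_div_le hT2 hδ0 hδ1 (by norm_num) (by positivity) ?_
    exact hNT.trans (le_self_pow₀ hT1 (by norm_num))
  have ha₃l : a₃ ≤ 12 * l := by
    have e : 12 * (T : ℝ) / (H * δ) = 12 * (T / H) / δ := by field_simp
    rw [ha₃, e]
    refine log_mul_div_le hT2 hδ0 hδ1 (by norm_num) (by positivity) ?_
    refine le_trans (div_le_self hT0.le ?_) (le_self_pow₀ hT1 (by norm_num))
    exact_mod_cast hH
  have ha₄l : a₄ ≤ 6 * l := by
    rw [ha₄e]
    exact log_mul_div_le hT2 hδ0 hδ1 (by norm_num) (by positivity) le_rfl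
  -- the bad events
  let B₁ : Fin (numBase T) → Set Ω := fun j => {ω | a₁ ≤ ∑ b ∈ Finset.range (T / H), (β * (1 -
        (if i b ω = j then
          1 / masterProb T H δ (fun k => i k ω) (fun t => reward μ x η c t ω) b j else 0) -
        β / masterProb T H δ (fun k => i k ω) (fun t => reward μ x η c t ω) b j))}
  let B₂ : Fin (numBase T) → Set Ω := fun j => {ω | a₂ ≤ ∑ b ∈ Finset.range (T / H),
        gamma (numBase T) (numBatch T H) / numBase T *
        ((if i b ω = j then
          1 / masterProb T H δ (fun k => i k ω) (fun t => reward μ x η c t ω) b j else 0) - 2)}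
  let B₃ : ℕ → Set Ω := fun b =>
    {ω | √(2 * a₃ * H) < |∑ t ∈ Finset.Ico (b * H) ((b + 1) * H), η t ω|}
  let B₄ : ℕ × ℕ → Set Ω := fun q =>
    {ω | ∃ k ≤ T, ((Finset.Ico q.1 k).filter fun t => x t ω = x q.1 ω).card = q.2 ∧
      √(2 * a₄ * q.2) < |∑ t ∈ (Finset.Ico q.1 k).filter fun t => x t ω = x q.1 ω, η t ω|}
  have hB₁ : P (⋃ j ∈ Finset.univ, B₁ j) ≤ ENNReal.ofReal (δ / 3) := by
    refine (measure_biUnion_finset_le_ofReal P _ B₁ fun j _ =>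
      measure_le_sum_one_sub_le hE hR hμ.continuous hH hN hM j hβ0.le a₁).trans_eq ?_
    rw [Finset.card_univ, Fintype.card_fin, Real.exp_neg, ha₁, Real.exp_log (by positivity)]
    congr 1; field_simp
  have hB₂ : P (⋃ j ∈ Finset.univ, B₂ j) ≤ ENNReal.ofReal (δ / 6) := by
    refine (measure_biUnion_finset_le_ofReal P _ B₂ fun j _ =>
      measure_le_sum_inv_le hE hR hμ.continuous hH hN hM j a₂).trans_eq ?_
    rw [Finset.card_univ, Fintype.card_fin, Real.exp_neg, ha₂, Real.exp_log (by positivity)]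
    congr 1; field_simp
  have hB₃ : P (⋃ b ∈ Finset.range (T / H), B₃ b) ≤ ENNReal.ofReal (δ / 6) := by
    refine (measure_biUnion_finset_le_ofReal P _ B₃ fun b hb =>
      measure_batch_noise_le hE hH ((Nat.mul_le_mul_right H (Finset.mem_range.1 hb)).trans
        (Nat.div_mul_le_self T H)) ha₃0).trans (ENNReal.ofReal_le_ofReal ?_)
    rw [Finset.card_range, Real.exp_neg, ha₃, Real.exp_log (by positivity)]
    calc ((T / H : ℕ) : ℝ) * (2 * (12 * T / (H * δ))⁻¹) ≤ T / H * (2 * (12 * T / (H * δ))⁻¹) := by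
          gcongr; exact Nat.cast_div_le
      _ = δ / 6 := by field_simp; norm_num
  have hB₄ : P (⋃ q ∈ Finset.range T ×ˢ Finset.Icc 1 T, B₄ q) ≤ ENNReal.ofReal (δ / 3) := by
    refine (measure_biUnion_finset_le_ofReal P _ B₄ fun q hq => ?_).trans_eq
      (b := ENNReal.ofReal ((Finset.range T ×ˢ Finset.Icc 1 T).card * (2 * Real.exp (-a₄)))) ?_
    · rw [Finset.mem_product, Finset.mem_range, Finset.mem_Icc] at hq
      exact measure_arm_noise_le hE hR hq.1 hq.2.1 ha₄0
    · rw [Finset.card_product, Finset.card_range, Nat.card_Icc, Real.exp_neg, ha₄e,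
        Real.exp_log (by positivity), Nat.add_sub_cancel]
      congr 1; push_cast; field_simp; norm_num
  set G := {ω | regret μ xopt T x ω ≤
      (18 * (1 + 4 * √(κ * 2 ^ d) + κ * 2 ^ d) + 1000) * l ^ 3 *
        ((T : ℝ) ^ ((d + 3) / (d + 4)) +
          totalCorruption T c ω ^ (1 / (d + 1)) * (T : ℝ) ^ ((d + 2) / (d + 3)))} with hG
  have hsub : Gᶜ ⊆ ((⋃ j ∈ Finset.univ, B₁ j) ∪ (⋃ j ∈ Finset.univ, B₂ j)) ∪
      ((⋃ b ∈ Finset.range (T / H), B₃ b) ∪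
        (⋃ q ∈ Finset.range T ×ˢ Finset.Icc 1 T, B₄ q)) := by
    intro ω hω
    by_contra hbad
    simp only [Set.mem_union, not_or, Set.mem_iUnion, not_exists, Finset.mem_univ, true_imp_iff,
      Finset.mem_range, Finset.mem_product, Finset.mem_Icc] at hbad
    obtain ⟨⟨hn₁, hn₂⟩, hn₃, hn₄⟩ := hbad
    refine hω ?_
    have hC0 : 0 ≤ totalCorruption T c ω := Finset.sum_nonneg fun _ _ => abs_nonneg _
    have hCT : totalCorruption T c ω ≤ T := by
      calc totalCorruption T c ω ≤ ∑ t ∈ Finset.range T, (1 : ℝ) :=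
            Finset.sum_le_sum fun t ht => hE.corruption_le_one t (Finset.mem_range.1 ht) ω
        _ = T := by simp
    -- This `j` depends on `ω` through the corruption, which is why the events `B₁` were excluded
    -- for every level.
    obtain ⟨j, hj1, hj2⟩ := exists_level hT2 hC0 hCT
    have hw1 : 1 ≤ level j := one_le_pow₀ (by norm_num)
    obtain ⟨s, hs⟩ := hR.zooming ω
    set C := totalCorruption T c ω with hC
    set K := H * (C / H) ^ (1 / (d + 1)) with hK
    set L := 4 * Real.log T + 2 * Real.log (2 / (δ / 3)) with hL
    have hLa : L = 2 * a₄ := by rw [hL, ha₄]; ring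
    set ν := √(2 * H * a₃) with hν
    set R := 6 * (1 + √(L * (κ * 2 ^ d)) + κ * 2 ^ d) *
        (H * max ((H : ℝ) ^ (-(1 / (d + 2)))) ((level j / H) ^ (1 / (d + 1)))) with hRdef
    have hR0 : 0 ≤ R := by
      have : 0 ≤ max ((H : ℝ) ^ (-(1 / (d + 2)))) ((level j / H) ^ (1 / (d + 1))) :=
        le_max_of_le_left (by positivity)
      positivity
    have hblock : ∀ b < T / H, (b + 1) * H ≤ T := fun b hb =>
      (Nat.mul_le_mul_right H hb).trans (Nat.div_mul_le_self T H)
    have hpath := path_regret_le (xopt := xopt) (x := fun t => x t ω) (η := fun t => η t ω)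
      (c := fun t => c t ω) (i := fun k => i k ω) (δ := δ) (β := β) (ν := ν) (R := R) (K := K)
      (a₁ := a₁) (a₂ := a₂) hμ01 hH hN hM rfl hβ hβ0 hβ2 hν hR0 (by positivity) ha₁0 ha₂0 j
      (fun b hb hij => ?_) (fun b hb => ?_)
      (fun b hb => batch_corruption_le hd (fun t ht => hE.corruption_le_one t ht ω) hH
        (hblock b hb))
      (le_of_not_ge (hn₁ j)) (fun k => le_of_not_ge (hn₂ k))
    · refine hpath.trans ?_
      refine total_le hd hκ hT2 hl1 (by linarith) (by linarith) hC0 hj2 (Real.sqrt_nonneg _)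
        ?_ rfl ?_
      · refine Real.sqrt_le_iff.2 ⟨by positivity, ?_⟩
        rw [mul_pow, Real.sq_sqrt hH0.le]
        have h1 : H * a₃ ≤ H * (12 * l) := by gcongr
        have h2 : H * (12 * l) ≤ H * (12 * l ^ 2) := by
          gcongr; exact le_self_pow₀ hl1 (by norm_num)
        have h3 : 0 ≤ H * l ^ 2 := by positivity
        linarith
      · have hlog : Real.log T ≤ l / 2 := by
          have := Real.log_neg hδ0 hδ1
          rw [hl, Real.log_div hT0.ne' hδ0.ne']
          linarith
        refine exp3_error_le hN hM ?_ hl1 ?_ ?_ hα0 hα2 hβ ha₁α ha₂l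
        · exact_mod_cast div_le_numBatch T H
        · linarith [numBase_le_log hT2]
        · linarith [Real.log_le_log (by positivity) hNT]
    · refine batch_gap_le (T := T) (δ := δ / 3) (η := fun t => η t ω) (c := fun t => c t ω)
        (s := s) hd hX hκ hμ hμ01 hopt hw1 (by linarith) hj1 (fun s' hs' n hn hnT k hk hcard => ?_)
        hH (hblock b hb) (fun t ht1 ht2 => ?_)
      · have := hn₄ (s', n) ⟨hs', hn, hnT⟩
        by_contra hlt
        exact this ⟨k, hk, hcard, not_le.1 hlt⟩
      · have h1 := hs t (by have := hblock b hb; omega)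
        have h2 : t / H = b := Nat.div_eq_of_lt_le ht1 ht2
        rw [h2, hij] at h1
        exact h1
    · have := hn₃ b hb
      rw [hν, mul_right_comm]
      exact not_lt.1 this
  have hbad : P Gᶜ ≤ ENNReal.ofReal δ := by
    refine (measure_mono hsub).trans ((measure_union_le _ _).trans
      ((add_le_add ((measure_union_le _ _).trans (add_le_add hB₁ hB₂))
        ((measure_union_le _ _).trans (add_le_add hB₃ hB₄))).trans_eq ?_))
    rw [← ENNReal.ofReal_add (by positivity) (by positivity),
      ← ENNReal.ofReal_add (by positivity) (by positivity),
      ← ENNReal.ofReal_add (by positivity) (by positivity)]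
    congr 1; ring
  -- Subadditivity alone is used here, so `G` need not be measurable.
  have hone : 1 ≤ P G + P Gᶜ := by
    rw [← measure_univ (μ := P), ← Set.union_compl_self G]
    exact measure_union_le _ _
  rw [ENNReal.ofReal_sub _ hδ0.le, ENNReal.ofReal_one]
  exact tsub_le_iff_right.2 (hone.trans (add_le_add_right hbad _))

/-- If the EXP3.P parameter `α` is large, then the regret bound is trivial. -/
theorem le_of_two_lt {d : ℝ} (hd : 0 ≤ d) (hT : 3 ≤ T) (hδ0 : 0 < δ) (hδ1 : δ < 1)
    (hβ : 2 < alpha (numBase T) (numBatch T (batchLength d T)) δ /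
      √((numBase T : ℝ) * numBatch T (batchLength d T))) :
    (T : ℝ) ≤ 6 * (2 * Real.log (T / δ)) * (T : ℝ) ^ ((d + 3) / (d + 4)) := by
  have hT2 : 2 ≤ T := by omega
  have hH : 0 < batchLength d T := batchLength_pos hT2
  have hHT : batchLength d T ≤ T := batchLength_le_self hd hT2
  obtain ⟨hα0, hα2, -⟩ := alpha_sq_le (δ := δ) hT hH hHT hδ0 hδ1
  have hl1 := one_le_two_mul_log hT2 hδ0 hδ1
  have hN0 : (2 : ℝ) ≤ numBase T := by exact_mod_cast two_le_numBase hT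
  have hM0 : (1 : ℝ) ≤ numBatch T (batchLength d T) := by exact_mod_cast numBatch_pos hH hHT
  rw [lt_div_iff₀ (by positivity)] at hβ
  have h1 : (2 * √((numBase T : ℝ) * numBatch T (batchLength d T))) ^ 2 ≤
      alpha (numBase T) (numBatch T (batchLength d T)) δ ^ 2 := by gcongr
  rw [mul_pow, Real.sq_sqrt (by positivity)] at h1
  -- A large bonus means few batches: `4 * N * M ≤ α ^ 2 ≤ 12 * l` for `l = 2 * log (T / δ)`, and `N
  -- ≥ 2`. Then `T ≤ M * H` is already of the order of the claimed bound.
  have h2 : (numBatch T (batchLength d T) : ℝ) ≤ 3 * (2 * Real.log (T / δ)) := by nlinarith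
  calc (T : ℝ) ≤ numBatch T (batchLength d T) * batchLength d T := le_numBatch_mul hH
    _ ≤ 3 * (2 * Real.log (T / δ)) * (2 * (T : ℝ) ^ ((d + 3) / (d + 4))) := by
        gcongr
        exact batchLength_le_rpow hd hT2
    _ = _ := by ring

end Main

end BoB

theorem theorem6 (d κ : ℝ) (hd : 0 ≤ d) (hκ : 0 < κ) :
    ∃ (A : ℝ) (p : ℕ),
      ∀ (X : Type*) [MetricSpace X] [CompactSpace X] [MeasurableSpace X] [BorelSpace X],
        Metric.diam (Set.univ : Set X) ≤ 1 → BoB.HasCoveringBound X d κ →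
      ∀ (μ : X → ℝ) (xopt : X),
        LipschitzWith 1 μ → (∀ x, μ x ∈ Set.Icc (0 : ℝ) 1) → (∀ x, μ x ≤ μ xopt) →
      ∀ (T : ℕ) (δ : ℝ), 2 ≤ T → 0 < δ → δ < 1 →
      ∀ (Ω : Type*) [mΩ : MeasurableSpace Ω] (P : Measure Ω) [IsProbabilityMeasure P]
        (ℱ : Filtration ℕ mΩ) (η c : ℕ → Ω → ℝ)
        (i : ℕ → Ω → Fin (BoB.numBase T)) (x : ℕ → Ω → X),
        BoB.IsEnvironment P ℱ T η c →
        BoB.IsRun P ℱ T (BoB.batchLength d T) δ i x (BoB.reward μ x η c) →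
        ENNReal.ofReal (1 - δ) ≤
          P {ω | BoB.regret μ xopt T x ω ≤
            A * Real.log (T / δ) ^ p *
              ((T : ℝ) ^ ((d + 3) / (d + 4)) +
                BoB.totalCorruption T c ω ^ (1 / (d + 1)) *
                  (T : ℝ) ^ ((d + 2) / (d + 3)))} := by
  -- The factor 8 is the cube of the 2 in `2 * log (T / δ)`.
  refine ⟨8 * (18 * (1 + 4 * √(κ * 2 ^ d) + κ * 2 ^ d) + 1000), 3, ?_⟩
  intro X _ _ _ _ _ hX μ xopt hμ hμ01 hopt T δ hT hδ0 hδ1 Ω mΩ P _ ℱ η c i x hE hR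
  set A := 18 * (1 + 4 * √(κ * 2 ^ d) + κ * 2 ^ d) + 1000 with hA
  have hA1 : 1000 ≤ A := by
    have : 0 ≤ 18 * (1 + 4 * √(κ * 2 ^ d) + κ * 2 ^ d) := by positivity
    linarith
  have hl1 := BoB.one_le_two_mul_log hT hδ0 hδ1
  have hT0 : (1 : ℝ) ≤ T := by exact_mod_cast (by omega : 1 ≤ T)
  have hpow : 8 * A * Real.log (T / δ) ^ 3 = A * (2 * Real.log (T / δ)) ^ 3 := by ring
  rw [hpow]
  have trivial_case : (T : ℝ) ≤ 6 * (2 * Real.log (T / δ)) * (T : ℝ) ^ ((d + 3) / (d + 4)) →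
      ENNReal.ofReal (1 - δ) ≤ P {ω | BoB.regret μ xopt T x ω ≤
        A * (2 * Real.log (T / δ)) ^ 3 * ((T : ℝ) ^ ((d + 3) / (d + 4)) +
          BoB.totalCorruption T c ω ^ (1 / (d + 1)) * (T : ℝ) ^ ((d + 2) / (d + 3)))} := by
    intro h
    have huniv : {ω | BoB.regret μ xopt T x ω ≤
        A * (2 * Real.log (T / δ)) ^ 3 * ((T : ℝ) ^ ((d + 3) / (d + 4)) +
          BoB.totalCorruption T c ω ^ (1 / (d + 1)) * (T : ℝ) ^ ((d + 2) / (d + 3)))} =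
        Set.univ := by
      refine Set.eq_univ_of_forall fun ω => ?_
      refine (BoB.regret_le hμ01 xopt T x ω).trans (h.trans ?_)
      have hC : 0 ≤ BoB.totalCorruption T c ω := Finset.sum_nonneg fun _ _ => abs_nonneg _
      have h3 : 2 * Real.log (T / δ) ≤ (2 * Real.log (T / δ)) ^ 3 :=
        le_self_pow₀ hl1 (by norm_num)
      gcongr
      · linarith
      · exact le_add_of_nonneg_right (by positivity)
    rw [huniv, measure_univ]
    exact ENNReal.ofReal_le_one.2 (by linarith)
  -- For `T = 2` there is a single level and `γ = 0`, so the EXP3.P analysis, which divides by `γ`,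
  -- does not apply; the regret is at most 2 anyway.
  rcases Nat.lt_or_ge T 3 with h | h
  · refine trivial_case ?_
    have hT2 : (T : ℝ) ≤ 2 := by exact_mod_cast (by omega : T ≤ 2)
    have h1 : 1 ≤ (T : ℝ) ^ ((d + 3) / (d + 4)) := Real.one_le_rpow hT0 (by positivity)
    nlinarith
  · rcases le_or_gt (BoB.alpha (BoB.numBase T) (BoB.numBatch T (BoB.batchLength d T)) δ /
        √((BoB.numBase T : ℝ) * BoB.numBatch T (BoB.batchLength d T))) 2 with hβ | hβ
    · exact BoB.measure_regret_ge_of_three_le hd hκ hX hμ hμ01 hopt h hδ0 hδ1 hE hR hβ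
    · exact trivial_case (BoB.le_of_two_lt hd h hδ0 hδ1 hβ)
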